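/- **Setting.** Let $V$ be a real vector space of finite dimension $r$ with an orientation $o$ and dual $V^*$, and let $\Delta\subset V\setminus\{0\}$ be a finite set that spans $V$ and satisfies $\Delta=-\Delta$. An element $y\in V^*$ is *regular* if $\langle\alpha,y\rangle\neq0$ for all $\alpha\in\Delta$. Let $G_\Delta$ be the real vector space of functions on the set of regular elements of $V^*$ spanned by the $\prod_{\alpha\in\kappa}\alpha^{-n_\alpha}$, where $\kappa\subset\Delta$ spans $V$ and all $n_\alpha$ are positive integers. For a positive integer $n$, a function $\phi\in G_\Delta$ *vanishes at order $n$ at infinity* if for every regular $y\in V^*$ and every nonzero $z\in V^*$ the rational function $t\mapsto\phi(y+tz)$ vanishes at order $n$ at infinity, that is, $t^{n-1}\phi(y+tz)\to0$ as $|t|\to\infty$. A *wall* is a hyperplane of $V$ spanned by $r-1$ linearly independent elements of $\Delta$; let $V_{reg}$ be the complement in $V$ of the union of the walls. Let $\delta$ be a connected component of the set of regular elements of $V^*$, and $\delta^\vee=\{h\in V:\langle y,h\rangle\ge0\ \text{for all}\ y\in\delta\}$. For a basis $\sigma\subset\Delta$ of $V$ let $[C(\sigma)]$ be the characteristic function of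 the closed convex cone $C(\sigma)$ generated by $\sigma$. Let $\mathcal P_\Delta(\delta)$ be the space of functions on $V_{reg}$ spanned by the $P\,[C(\sigma)]$, with $P$ a polynomial function on $V$ and $\sigma\subset\Delta$ a basis of $V$ such that $C(\sigma)\subset\delta^\vee$. For $0\ne dy\in\wedge^rV$ and $\phi\in G_\Delta$, the inverse Laplace transform $F^o_\delta(\phi\otimes dy)$ is the unique $f\in\mathcal P_\Delta(\delta)$ such that $$\int_{V,o}e^{-\langle y,h\rangle}f(h)\,\omega=\phi(y)\,\langle dy,\omega\rangle\qquad\text{for all }y\in\delta,\ \omega\in\wedge^rV^*.$$ **Statement.** Let $0\neq dy\in\wedge^r V$, let $\phi\in G_\Delta$, and let $k\ge0$ be an integer. The following conditions are equivalent: 1. $F^o_\delta(\phi\otimes dy)$ extends to a function of class $C^k$ on $V$; 2. $\phi$ vanishes at order $k+2$ at infinity. Further, if $\phi$ satisfies (1) or (2) and $V_0$ is a wall with equation $z_0=0$, where $z_0\in V^*$, then the following conditions are equivalent: 1'. $F^o_\delta(\phi\otimes dy)$ extends to a function of class $C^{k+1}$ along $V_0$, that is, to a function of class $C^{k+1}$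 on the complement in $V$ of the union of the walls other than $V_0$; 2'. for every regular $z\in V^*$, the rational function $t\mapsto\phi(z+tz_0)$ vanishes at order $k+3$ at infinity, that is, $t^{k+2}\phi(z+tz_0)\to0$ as $|t|\to\infty$. -/

import Mathlib

open Module Set Filter Topology MeasureTheory

noncomputable section

namespace HyperplaneLaplace

variable {V : Type*} [NormedAddCommGroup V] [NormedSpace ℝ V]

/-- Extension by zero of a real function defined on a subset. -/
def extendByZero {X : Type*} (S : Set X) (f : S → ℝ) : X → ℝ :=
  Function.extend Subtype.val f 0

/-- The regular elements of `V*`: the complement of the hyperplanes `α = 0`, `α ∈ Δ`. -/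
def dualReg (Δ : Finset V) : Set (StrongDual ℝ V) :=
  {y | ∀ α ∈ Δ, y α ≠ 0}

/-- A chamber of `V*`: a connected component of the set of regular elements of `V*`. -/
def IsDualChamber (Δ : Finset V) (δ : Set (StrongDual ℝ V)) : Prop :=
  ∃ y ∈ dualReg Δ, δ = connectedComponentIn (dualReg Δ) y

/-- The closed dual cone in `V` of a subset of `V*`. -/
def dualCone (δ : Set (StrongDual ℝ V)) : Set V :=
  {h | ∀ y ∈ δ, 0 ≤ y h}

/-- The space `G_Δ`, spanned by the `1 / ∏_{α ∈ κ} α ^ n_α` with `κ ⊆ Δ` generating and all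
`n_α` positive; rational functions with poles on the hyperplanes `α = 0` are regarded as functions
on the set of regular elements of `V*`. -/
def G (Δ : Finset V) : Submodule ℝ (dualReg Δ → ℝ) :=
  Submodule.span ℝ {φ | ∃ (κ : Finset V) (n : V → ℕ), κ ⊆ Δ ∧
    Submodule.span ℝ (κ : Set V) = ⊤ ∧ (∀ α ∈ κ, 0 < n α) ∧
    φ = fun y : dualReg Δ => (∏ α ∈ κ, (y : StrongDual ℝ V) α ^ n α)⁻¹}

/-- The rational function `t ↦ t ^ (n - 1) * φ (y + t z)` is `0` at infinity (`n` positive). For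
regular `y` the point `y + t z` is regular for all but finitely many `t`. -/
def VanishesAtOrderAlong {Δ : Finset V} (φ : dualReg Δ → ℝ) (n : ℕ) (y z : StrongDual ℝ V) :
    Prop :=
  Tendsto (fun t : ℝ => t ^ (n - 1) * extendByZero (dualReg Δ) φ (y + t • z))
    (Bornology.cobounded ℝ) (𝓝 0)

/-- `φ` vanishes at order `n` at infinity (`n` positive). -/
def VanishesAtOrder {Δ : Finset V} (φ : dualReg Δ → ℝ) (n : ℕ) : Prop :=
  ∀ y ∈ dualReg Δ, ∀ z : StrongDual ℝ V, z ≠ 0 → VanishesAtOrderAlong φ n y z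

/-- A wall of `V`: a hyperplane spanned by `dim V - 1` linearly independent elements of `Δ`. -/
def IsWall (Δ : Finset V) (W : Submodule ℝ V) : Prop :=
  ∃ s : Finset V, s ⊆ Δ ∧ LinearIndepOn ℝ id (s : Set V) ∧ s.card + 1 = finrank ℝ V ∧
    W = Submodule.span ℝ (s : Set V)

/-- The regular elements of `V`: the complement of the union of the walls. -/
def reg (Δ : Finset V) : Set V :=
  {h | ∀ W : Submodule ℝ V, IsWall Δ W → h ∉ W}

/-- The complement in `V` of the union of the walls other than `V₀`. -/
def regAlong (Δ : Finset V) (V₀ : Submodule ℝ V) : Set V :=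
  {h | ∀ W : Submodule ℝ V, IsWall Δ W → W ≠ V₀ → h ∉ W}

/-- The polynomial functions on `V`. -/
def polyFun (V : Type*) [NormedAddCommGroup V] [NormedSpace ℝ V] : Subalgebra ℝ (V → ℝ) :=
  Algebra.adjoin ℝ (range fun l : StrongDual ℝ V => (l : V → ℝ))

/-- The closed convex cone `C(σ)` generated by a finite set `σ`. -/
def cone (σ : Finset V) : Set V :=
  (PointedCone.hull ℝ (σ : Set V) : Set V)

/-- The space `P_Δ(δ)` of locally polynomial functions on the set of regular elements of `V`
spanned by the `f [C(σ)]`, with `f` polynomial and `σ ⊆ Δ` a basis of `V` such that `C(σ)` is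
contained in the dual cone of `δ`. -/
def locPoly (Δ : Finset V) (δ : Set (StrongDual ℝ V)) : Submodule ℝ (reg Δ → ℝ) :=
  Submodule.span ℝ {F | ∃ f ∈ polyFun V, ∃ σ : Finset V, σ ⊆ Δ ∧
    LinearIndepOn ℝ id (σ : Set V) ∧ Submodule.span ℝ (σ : Set V) = ⊤ ∧
    cone σ ⊆ dualCone δ ∧ F = fun h : reg Δ => (cone σ).indicator f (h : V)}

variable [FiniteDimensional ℝ V] [MeasurableSpace V] [BorelSpace V]
  {r : ℕ} [Fact (finrank ℝ V = r)]

open Classical in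
/-- The integral `∫_{V,o} g ω` of a differential form `g ω` of top degree on `V`, where `ω` is a
constant form: the integral of `g` for the density `|ω|`, with the sign `+` if `ω` is positive
for `o` and `-` otherwise. -/
def orientedIntegral (o : Orientation ℝ V (Fin r)) (g : V → ℝ) (ω : V [⋀^Fin r]→ₗ[ℝ] ℝ) : ℝ :=
  if ∃ hω : ω ≠ 0, rayOfNeZero ℝ ω hω = o then ∫ h, g h ∂ω.measure else -∫ h, g h ∂ω.measure

/-- The Laplace transform `L^o(f)` of a function on the regular elements of `V`. Its value at `y`
is an element of the dual of `⋀^r V*`; `laplace o f y ω` is the pairing of that value with `ω`. -/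
def laplace {Δ : Finset V} (o : Orientation ℝ V (Fin r)) (f : reg Δ → ℝ) (y : StrongDual ℝ V)
    (ω : V [⋀^Fin r]→ₗ[ℝ] ℝ) : ℝ :=
  orientedIntegral o (fun h => Real.exp (-y h) * extendByZero (reg Δ) f h) ω

/-- The rational function `φ ⊗ dy` with values in `⋀^r V` is the Laplace transform of `f` on
`δ`. -/
def IsLaplaceTransform {Δ : Finset V} (o : Orientation ℝ V (Fin r)) (δ : Set (StrongDual ℝ V))
    (f : reg Δ → ℝ) (φ : dualReg Δ → ℝ) (dy : ⋀[ℝ]^r V) : Prop :=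
  ∀ y : dualReg Δ, (y : StrongDual ℝ V) ∈ δ → ∀ ω : V [⋀^Fin r]→ₗ[ℝ] ℝ,
    laplace o f y ω = φ y * exteriorPower.alternatingMapLinearEquiv ω dy

open Classical in
/-- The inverse Laplace transform `F_δ^o (φ ⊗ dy)`: the element of `P_Δ(δ)` whose Laplace
transform is `φ ⊗ dy` (and the junk value `0` where there is no such element). -/
def invLaplace {Δ : Finset V} (o : Orientation ℝ V (Fin r)) (δ : Set (StrongDual ℝ V))
    (φ : dualReg Δ → ℝ) (dy : ⋀[ℝ]^r V) : reg Δ → ℝ :=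
  if H : ∃ f ∈ locPoly Δ δ, IsLaplaceTransform o δ f φ dy then H.choose else 0

/-- `f` extends to a function of class `C^k` on `V`. -/
def ExtendsOfClass {V : Type*} [NormedAddCommGroup V] [NormedSpace ℝ V] {Δ : Finset V}
    (f : reg Δ → ℝ) (k : ℕ) : Prop :=
  ∃ g : V → ℝ, (∀ h : reg Δ, g h = f h) ∧ ContDiff ℝ k g

/-- `f` extends to a function of class `C^k` along the wall `V₀`, that is, to a function of class
`C^k` on the complement of the union of the other walls. -/
def ExtendsOfClassAlong {V : Type*} [NormedAddCommGroup V] [NormedSpace ℝ V] {Δ : Finset V}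
    (f : reg Δ → ℝ) (k : ℕ) (V₀ : Submodule ℝ V) : Prop :=
  ∃ g : V → ℝ, (∀ h : reg Δ, g h = f h) ∧ ContDiffOn ℝ k g (regAlong Δ V₀)

end HyperplaneLaplace

end

/-! Fix a nonzero `ω` that is positive for `o`. On regular points, every element of `P_Δ(δ)` is `fn
c` for a formal combination `c` of monomials on simplicial cones, and the Laplace transform of such
a monomial is explicit: a constant times `∏ 1 / y (b i) ^ (m i + 1)`. By partial fractions
(`exists_lap_eq_inv_prod`) every element of `G Δ` has the form `lap ω c`, so the theorem compares
the smoothness of `fn c` with the decay of `lap ω c`. Working with formal combinations lets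
derivatives and leading coefficients be defined on generators and extended linearly, with no
well-definedness to check.

Continuity. As `|t| → ∞`, `t * lap ω c (y + t • z)` tends to `boundary ω z c y`, so vanishing at
order 2 means that all these limits are zero. Only directions `z` whose kernel is a wall matter. For
such `z` choose `β ∈ Δ` positive on `δ` with `z β ≠ 0`. Then `|z β| * boundary ω z c y / y β` is the
Laplace transform of the jump of `fn c` across the wall, transported constantly along the rays in
direction `β` (`exists_jump`). The Laplace transform is injective (`ae_eq_zero_of_laplace_eq_zero`),
so the jump is zero exactly when the boundary term is. Continuity at points lying on a single wall
is enough for continuity on `V`: the other bad points have codimension at least two, generic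
segments avoid them, and bounded derivatives give local Lipschitz estimates
(`extOn_univ_of_atMostOneWall`).

Higher order. The difference between `y v * lap ω c y` and the transform of the derivative along `v`
is a sum of boundary terms over the walls (`lap_dirDeriv_defect`). For continuous `fn c` it
vanishes, and differentiation becomes multiplication by `y v`. Along `y + t • z` this factor is `y v
+ t * z v`: it costs at most one order of decay, and exactly one if `z v ≠ 0`. Together with
`extOn_succ_iff` this gives the induction on `k`. For one wall the same induction starts from the
jump across that wall alone; the global `C^k` hypothesis supplies the continuity needed at each
differentiation. -/

set_option linter.unusedSectionVars false

noncomputable section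

namespace HyperplaneLaplace

section

open scoped Nat

/-! ### Truncated powers -/

/-- The truncated power `x ↦ x ^ m` for `x > 0`, and `0` elsewhere. -/
def truncPow (m : ℕ) (x : ℝ) : ℝ := if 0 < x then x ^ m else 0

lemma truncPow_of_pos {m : ℕ} {x : ℝ} (hx : 0 < x) : truncPow m x = x ^ m := if_pos hx

lemma truncPow_of_nonpos {m : ℕ} {x : ℝ} (hx : x ≤ 0) : truncPow m x = 0 := if_neg hx.not_gt

lemma abs_truncPow_le (m : ℕ) (x : ℝ) : |truncPow m x| ≤ |x| ^ m := by
  unfold truncPow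
  split_ifs with h
  · rw [abs_pow]
  · simp

lemma measurable_truncPow (m : ℕ) : Measurable (truncPow m) :=
  Measurable.ite measurableSet_Ioi (by fun_prop) measurable_const

lemma truncPow_eventuallyEq_of_pos {m : ℕ} {x : ℝ} (hx : 0 < x) :
    truncPow m =ᶠ[𝓝 x] fun t => t ^ m := by
  filter_upwards [lt_mem_nhds hx] with t ht using truncPow_of_pos ht

lemma truncPow_eventuallyEq_of_neg {m : ℕ} {x : ℝ} (hx : x < 0) :
    truncPow m =ᶠ[𝓝 x] fun _ => 0 := by
  filter_upwards [gt_mem_nhds hx] with t ht using truncPow_of_nonpos ht.le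

/-- For `m = 0` the truncated exponent `m - 1` does no harm, because the factor `m` is zero. -/
lemma hasDerivAt_truncPow (m : ℕ) {x : ℝ} (hx : x ≠ 0) :
    HasDerivAt (truncPow m) (m * truncPow (m - 1) x) x := by
  rcases lt_or_gt_of_ne hx with h | h
  · rw [truncPow_of_nonpos h.le, mul_zero]
    exact (hasDerivAt_const x (0 : ℝ)).congr_of_eventuallyEq (truncPow_eventuallyEq_of_neg h)
  · rw [truncPow_of_pos h]
    exact (hasDerivAt_pow m x).congr_of_eventuallyEq (truncPow_eventuallyEq_of_pos h)

lemma continuousAt_truncPow (m : ℕ) {x : ℝ} (hx : x ≠ 0) : ContinuousAt (truncPow m) x :=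
  (hasDerivAt_truncPow m hx).continuousAt

lemma continuous_truncPow_of_pos {m : ℕ} (hm : 0 < m) : Continuous (truncPow m) := by
  have : truncPow m = fun x => (max x 0) ^ m := by
    funext x
    rcases lt_or_ge 0 x with h | h
    · rw [truncPow_of_pos h, max_eq_left h.le]
    · rw [truncPow_of_nonpos h, max_eq_right h, zero_pow hm.ne']
  rw [this]
  fun_prop

lemma exp_mul_truncPow_eq_indicator (m : ℕ) (s : ℝ) :
    (fun x => Real.exp (-(s * x)) * truncPow m x) =
      (Ioi 0).indicator fun x => x ^ (((m : ℝ) + 1) - 1) * Real.exp (-(s * x)) := by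
  funext x
  by_cases h : x ∈ Ioi (0 : ℝ)
  · rw [indicator_of_mem h, truncPow_of_pos h, add_sub_cancel_right, Real.rpow_natCast, mul_comm]
  · rw [indicator_of_notMem h, truncPow_of_nonpos (not_lt.1 h), mul_zero]

lemma integral_exp_mul_truncPow (m : ℕ) {s : ℝ} (hs : 0 < s) :
    ∫ x, Real.exp (-(s * x)) * truncPow m x = m ! / s ^ (m + 1) := by
  rw [exp_mul_truncPow_eq_indicator, integral_indicator measurableSet_Ioi,
    Real.integral_rpow_mul_exp_neg_mul_Ioi (by positivity) hs, Real.Gamma_nat_eq_factorial,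
    one_div, Real.inv_rpow hs.le]
  norm_cast
  field_simp

lemma integrable_exp_mul_truncPow (m : ℕ) {s : ℝ} (hs : 0 < s) :
    Integrable fun x => Real.exp (-(s * x)) * truncPow m x :=
  -- The Bochner integral of a non-integrable function is `0`, so the nonzero value of the Gamma
  -- integral proves integrability.
  Integrable.of_integral_ne_zero (by
    rw [integral_exp_mul_truncPow m hs]
    positivity)

/-! ### Bases positive on a chamber, and formal combinations -/

/-- A basis of `V` whose elements belong to `Δ` and are positive on `δ`. -/
structure PosBasis {V : Type*} [NormedAddCommGroup V] [NormedSpace ℝ V] (Δ : Finset V)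
    (δ : Set (StrongDual ℝ V)) (r : ℕ) where
  /-- The underlying basis. -/
  basis : Basis (Fin r) ℝ V
  mem : ∀ i, basis i ∈ Δ
  pos : ∀ i, ∀ y ∈ δ, 0 < y (basis i)

variable {V : Type*} [NormedAddCommGroup V] [NormedSpace ℝ V]
  {Δ : Finset V} {δ : Set (StrongDual ℝ V)} {r : ℕ}

/-- The formal linear combinations of monomials on the cones of positive bases. -/
abbrev Comb (Δ : Finset V) (δ : Set (StrongDual ℝ V)) (r : ℕ) : Type _ :=
  (PosBasis Δ δ r × (Fin r → ℕ)) →₀ ℝ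

/-- The monomial with exponents `m` in the coordinates of `b`, restricted to the open cone
generated by `b`. -/
def genFun (b : Basis (Fin r) ℝ V) (m : Fin r → ℕ) (h : V) : ℝ :=
  ∏ i, truncPow (m i) (b.repr h i)

/-- The Laplace transform of `genFun b m` for the density defined by `ω`. -/
def genLap (ω : V [⋀^Fin r]→ₗ[ℝ] ℝ) (b : Basis (Fin r) ℝ V) (m : Fin r → ℕ)
    (y : StrongDual ℝ V) : ℝ :=
  |ω b| * ∏ i, ((m i)! / y (b i) ^ (m i + 1) : ℝ)

/-- The function on `V` defined by a formal combination. -/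
def fn : Comb Δ δ r →ₗ[ℝ] V → ℝ :=
  Finsupp.linearCombination ℝ fun p => genFun p.1.basis p.2

/-- The Laplace transform of a formal combination. -/
def lap (ω : V [⋀^Fin r]→ₗ[ℝ] ℝ) : Comb Δ δ r →ₗ[ℝ] StrongDual ℝ V → ℝ :=
  Finsupp.linearCombination ℝ fun p => genLap ω p.1.basis p.2

lemma fn_single (b : PosBasis Δ δ r) (m : Fin r → ℕ) (a : ℝ) :
    fn (Finsupp.single (b, m) a) = a • genFun b.basis m :=
  Finsupp.linearCombination_single ..

lemma lap_single (ω : V [⋀^Fin r]→ₗ[ℝ] ℝ) (b : PosBasis Δ δ r) (m : Fin r → ℕ) (a : ℝ) :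
    lap ω (Finsupp.single (b, m) a) = a • genLap ω b.basis m :=
  Finsupp.linearCombination_single ..

/-- Induction principle for formal combinations. -/
lemma Comb.induction {p : Comb Δ δ r → Prop} (c : Comb Δ δ r) (zero : p 0)
    (add : ∀ c d, p c → p d → p (c + d)) (smul : ∀ (a : ℝ) c, p c → p (a • c))
    (single : ∀ b m, p (Finsupp.single (b, m) 1)) : p c := by
  induction c using Finsupp.induction_linear with
  | zero => exact zero
  | add c d hc hd => exact add c d hc hd
  | single q a =>
    have := smul a _ (single q.1 q.2)
    rwa [Finsupp.smul_single, smul_eq_mul, mul_one] at this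

lemma continuous_repr (b : Basis (Fin r) ℝ V) (i : Fin r) : Continuous fun h => b.repr h i := by
  have := b.finiteDimensional_of_finite
  exact (b.coord i).continuous_of_finiteDimensional

lemma measurable_genFun [MeasurableSpace V] [BorelSpace V] (b : Basis (Fin r) ℝ V)
    (m : Fin r → ℕ) : Measurable (genFun b m) :=
  Finset.measurable_prod _ fun i _ =>
    (measurable_truncPow (m i)).comp (continuous_repr b i).measurable

lemma measurable_fn [MeasurableSpace V] [BorelSpace V] (c : Comb Δ δ r) : Measurable (fn c) := by
  induction c using Comb.induction with
  | zero => rw [map_zero]; exact measurable_zero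
  | add c d hc hd => rw [map_add]; exact hc.add hd
  | smul a c hc => rw [map_smul]; exact hc.const_smul a
  | single b m => rw [fn_single]; exact (measurable_genFun _ m).const_smul _

/-! ### Laplace transforms of formal combinations -/

section Integral

variable [FiniteDimensional ℝ V] [MeasurableSpace V] [BorelSpace V] [Fact (finrank ℝ V = r)]

/-- By uniqueness of Haar measure it is enough to compare the two measures on the parallelepiped of
`b`: one gives it mass `|ω b|`, the other mass `1`. -/
lemma measure_eq_smul_addHaar (ω : V [⋀^Fin r]→ₗ[ℝ] ℝ) (b : Basis (Fin r) ℝ V) :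
    ω.measure = ENNReal.ofReal |ω b| • b.addHaar := by
  rw [Basis.addHaar_def, MeasureTheory.Measure.addHaarMeasure_unique ω.measure b.parallelepiped,
    Basis.coe_parallelepiped, ω.measure_parallelepiped]

/-- In the coordinates of `b` the measure is Lebesgue measure, so Laplace integrals over the cone of
`b` split by Fubini into one-dimensional ones. -/
lemma map_equivFun_addHaar (b : Basis (Fin r) ℝ V) :
    Measure.map b.equivFunL b.addHaar = volume := by
  rw [Basis.map_addHaar, ← addHaarMeasure_eq_volume_pi, ← Basis.parallelepiped_basisFun,
    Basis.addHaar_def]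
  congr 2
  ext i j
  simp [Finsupp.single_apply, Pi.single_apply, eq_comm]

lemma exp_mul_genFun (b : Basis (Fin r) ℝ V) (m : Fin r → ℕ) (y : StrongDual ℝ V) (h : V) :
    Real.exp (-y h) * genFun b m h =
      ∏ i, Real.exp (-(y (b i) * b.equivFunL h i)) * truncPow (m i) (b.equivFunL h i) := by
  rw [Finset.prod_mul_distrib, ← Real.exp_sum, Finset.sum_neg_distrib]
  congr 3
  conv_lhs => rw [← b.sum_repr h, map_sum]
  refine Finset.sum_congr rfl fun i _ => ?_
  rw [map_smul, smul_eq_mul, mul_comm]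
  rfl

lemma integrable_exp_mul_genFun_addHaar (b : Basis (Fin r) ℝ V) (m : Fin r → ℕ)
    {y : StrongDual ℝ V} (hy : ∀ i, 0 < y (b i)) :
    Integrable (fun h => Real.exp (-y h) * genFun b m h) b.addHaar := by
  simp_rw [exp_mul_genFun]
  have := Integrable.fintype_prod (fun i => integrable_exp_mul_truncPow (m i) (hy i))
  rw [← volume_pi, ← map_equivFun_addHaar b] at this
  exact this.comp_measurable b.equivFunL.continuous.measurable

lemma integral_exp_mul_genFun_addHaar (b : Basis (Fin r) ℝ V) (m : Fin r → ℕ)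
    {y : StrongDual ℝ V} (hy : ∀ i, 0 < y (b i)) :
    ∫ h, Real.exp (-y h) * genFun b m h ∂b.addHaar =
      ∏ i, ((m i)! / y (b i) ^ (m i + 1) : ℝ) := by
  simp_rw [exp_mul_genFun]
  have := integral_fintype_prod_volume_eq_prod
    (fun (i : Fin r) (x : ℝ) => Real.exp (-(y (b i) * x)) * truncPow (m i) x)
  rw [← map_equivFun_addHaar b, ← b.equivFunL.coe_toHomeomorph,
    b.equivFunL.toHomeomorph.measurableEmbedding.integral_map] at this
  refine this.trans (Finset.prod_congr rfl fun i _ => integral_exp_mul_truncPow (m i) (hy i))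

lemma integrable_exp_mul_fn (ω : V [⋀^Fin r]→ₗ[ℝ] ℝ) (c : Comb Δ δ r) {y : StrongDual ℝ V}
    (hy : y ∈ δ) : Integrable (fun h => Real.exp (-y h) * fn c h) ω.measure := by
  induction c using Comb.induction with
  | zero => simp
  | add c d hc hd =>
    simp only [map_add, Pi.add_apply, mul_add]
    exact hc.add hd
  | smul a c hc =>
    simp only [map_smul, Pi.smul_apply, smul_eq_mul, mul_left_comm _ a]
    exact hc.const_mul a
  | single b m =>
    rw [measure_eq_smul_addHaar ω b.basis]
    simpa [fn_single] using (integrable_exp_mul_genFun_addHaar b.basis m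
      fun i => b.pos i y hy).smul_measure ENNReal.ofReal_ne_top

/-- The Laplace transform of a combination, as an integral. -/
lemma integral_exp_mul_fn (ω : V [⋀^Fin r]→ₗ[ℝ] ℝ) (c : Comb Δ δ r) {y : StrongDual ℝ V}
    (hy : y ∈ δ) : ∫ h, Real.exp (-y h) * fn c h ∂ω.measure = lap ω c y := by
  induction c using Comb.induction with
  | zero => simp
  | add c d hc hd =>
    simp only [map_add, Pi.add_apply, mul_add]
    rw [integral_add (integrable_exp_mul_fn ω c hy) (integrable_exp_mul_fn ω d hy), hc, hd]
  | smul a c hc =>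
    simp only [map_smul, Pi.smul_apply, smul_eq_mul, mul_left_comm _ a]
    rw [integral_const_mul, hc]
  | single b m =>
    simp only [fn_single, lap_single, one_smul]
    rw [measure_eq_smul_addHaar ω b.basis, integral_smul_measure,
      integral_exp_mul_genFun_addHaar b.basis m fun i => b.pos i y hy, genLap,
      ENNReal.toReal_ofReal (abs_nonneg _), smul_eq_mul]

end Integral

end

section

/-! ### Injectivity of the Laplace transform -/

section Injectivity

variable {E : Type*} [NormedAddCommGroup E] [NormedSpace ℝ E] [FiniteDimensional ℝ E]
  [MeasurableSpace E] [BorelSpace E]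

open ProbabilityTheory

/-- The density is the positive part of `u`, and `g * u⁺ = (g * u)⁺` because `g ≥ 0`. -/
lemma integrable_withDensity_ofReal {μ : Measure E} {u g : E → ℝ} (hu : Measurable u)
    (hg : ∀ x, 0 ≤ g x) (h : Integrable (fun x => g x * u x) μ) :
    Integrable g (μ.withDensity fun x => ENNReal.ofReal (u x)) := by
  rw [integrable_withDensity_iff_integrable_smul' hu.ennreal_ofReal (by simp)]
  refine h.pos_part.congr (Eventually.of_forall fun x => ?_)
  simp only [ENNReal.toReal_ofReal', smul_eq_mul]
  rw [mul_comm, max_mul_of_nonneg _ _ (hg x), zero_mul]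

lemma integral_withDensity_ofReal_sub {μ : Measure E} {u g : E → ℝ} (hu : Measurable u)
    (hg : ∀ x, 0 ≤ g x) (h : Integrable (fun x => g x * u x) μ) :
    ∫ x, g x ∂(μ.withDensity fun x => ENNReal.ofReal (u x)) -
      ∫ x, g x ∂(μ.withDensity fun x => ENNReal.ofReal (-u x)) = ∫ x, g x * u x ∂μ := by
  have h1 := integrable_withDensity_ofReal hu hg h
  have h2 := integrable_withDensity_ofReal hu.neg hg (by simpa using h.neg)
  rw [integrable_withDensity_iff_integrable_smul' hu.ennreal_ofReal (by simp)] at h1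
  rw [integrable_withDensity_iff_integrable_smul' hu.neg.ennreal_ofReal (by simp)] at h2
  have e1 := integral_withDensity_eq_integral_toReal_smul hu.ennreal_ofReal
    (ae_of_all μ (by simp)) g
  have e2 := integral_withDensity_eq_integral_toReal_smul hu.neg.ennreal_ofReal
    (ae_of_all μ (by simp)) g
  simp only [Pi.neg_apply] at h2 e2
  rw [e1, e2, ← integral_sub h1 h2]
  congr 1
  funext x
  simp only [ENNReal.toReal_ofReal', smul_eq_mul, ← sub_mul, mul_comm (g x)]
  congr 1
  rcases le_total 0 (u x) with hx | hx <;> simp [hx]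

/-- A measurable function whose Laplace transform is defined and vanishes on a nonempty open set
vanishes almost everywhere. -/
theorem ae_eq_zero_of_laplace_eq_zero {μ : Measure E} {F : E → ℝ} (hF : Measurable F)
    {Ω : Set (StrongDual ℝ E)} (hΩ : IsOpen Ω) (hne : Ω.Nonempty)
    (hint : ∀ y ∈ Ω, Integrable (fun h => Real.exp (-y h) * F h) μ)
    (hzero : ∀ y ∈ Ω, ∫ h, Real.exp (-y h) * F h ∂μ = 0) : F =ᵐ[μ] 0 := by
  obtain ⟨y₀, hy₀⟩ := hne
  -- Tilting by `exp (-y₀)` makes the function integrable, so its positive and negative parts are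
  -- densities of finite measures `ν₁`, `ν₂`; it suffices to show that these coincide.
  set u : E → ℝ := fun h => Real.exp (-y₀ h) * F h with hu_def
  have hu : Measurable u := by fun_prop
  set ν₁ := μ.withDensity fun x => ENNReal.ofReal (u x)
  set ν₂ := μ.withDensity fun x => ENNReal.ofReal (-u x)
  have hui : Integrable u μ := hint y₀ hy₀
  have hfin₁ : ∫⁻ x, ENNReal.ofReal (u x) ∂μ ≠ ⊤ := hui.lintegral_lt_top.ne
  have : IsFiniteMeasure ν₁ := isFiniteMeasure_withDensity_ofReal hui.2
  have : IsFiniteMeasure ν₂ := isFiniteMeasure_withDensity_ofReal hui.neg.2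
  have hexp : ∀ (L : StrongDual ℝ E) (t : ℝ) (h : E),
      Real.exp (t * L h) * u h = Real.exp (-(y₀ - t • L) h) * F h := by
    intro L t h
    simp only [hu_def, ← mul_assoc, ← Real.exp_add]
    congr 2
    simp
    ring
  have hν : ν₁ = ν₂ := by
    refine Measure.ext_of_charFunDual (funext fun L => ?_)
    have hL : Continuous fun t : ℝ => y₀ - t • L := by fun_prop
    obtain ⟨ε, hε, hball⟩ := Metric.isOpen_iff.1 (hΩ.preimage hL) 0 (by simpa using hy₀)
    have hI : ∀ t ∈ Metric.ball (0 : ℝ) ε, Integrable (fun x => Real.exp (t * L x) * u x) μ := by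
      intro t ht
      simp_rw [hexp]
      exact hint _ (hball ht)
    have hsub₁ : Metric.ball (0 : ℝ) ε ⊆ interior (integrableExpSet L ν₁) :=
      interior_maximal (fun t ht => integrable_withDensity_ofReal hu (fun _ => by positivity)
        (hI t ht)) Metric.isOpen_ball
    have hsub₂ : Metric.ball (0 : ℝ) ε ⊆ interior (integrableExpSet L ν₂) :=
      interior_maximal (fun t ht => integrable_withDensity_ofReal hu.neg (fun _ => by positivity)
        (by simpa using (hI t ht).neg)) Metric.isOpen_ball
    have hmgf : ∀ t ∈ Metric.ball (0 : ℝ) ε, mgf L ν₁ t = mgf L ν₂ t := by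
      intro t ht
      rw [← sub_eq_zero]
      refine (integral_withDensity_ofReal_sub hu (fun _ => by positivity) (hI t ht)).trans ?_
      simp_rw [hexp]
      exact hzero _ (hball ht)
    -- The complex moment generating functions are analytic on a vertical strip around the imaginary
    -- axis and agree on a real interval, hence at `I`, where they are the characteristic functions
    -- at `L`.
    have hcm : complexMGF L ν₁ Complex.I = complexMGF L ν₂ Complex.I := by
      set S : Set ℂ := {z | z.re ∈ Metric.ball (0 : ℝ) ε}
      have h₁ : AnalyticOnNhd ℂ (complexMGF L ν₁) S :=
        analyticOnNhd_complexMGF.mono fun z hz => hsub₁ hz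
      have h₂ : AnalyticOnNhd ℂ (complexMGF L ν₂) S :=
        analyticOnNhd_complexMGF.mono fun z hz => hsub₂ hz
      have hS : IsPreconnected S :=
        ((convex_ball (0 : ℝ) ε).linear_preimage Complex.reLm).isPreconnected
      refine AnalyticOnNhd.eqOn_of_preconnected_of_frequently_eq h₁ h₂ hS (z₀ := 0)
        (by simpa [S] using hε) ?_ (by simpa [S] using hε)
      have hT : Tendsto (fun t : ℝ => (t : ℂ)) (𝓝[≠] 0) (𝓝[≠] 0) := by
        refine tendsto_nhdsWithin_iff.2 ⟨?_, ?_⟩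
        · exact (Complex.continuous_ofReal.tendsto' 0 0 (by simp)).mono_left nhdsWithin_le_nhds
        · filter_upwards [self_mem_nhdsWithin] with t ht
          simpa using ht
      refine hT.frequently (Eventually.frequently ?_)
      filter_upwards [nhdsWithin_le_nhds (Metric.ball_mem_nhds (0 : ℝ) hε)] with t ht
      rw [complexMGF_ofReal, complexMGF_ofReal, hmgf t ht]
    simp only [complexMGF] at hcm
    simpa only [charFunDual_apply, mul_comm Complex.I] using hcm
  have hae := (withDensity_eq_iff hu.ennreal_ofReal.aemeasurable
    hu.neg.ennreal_ofReal.aemeasurable hfin₁).1 hν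
  filter_upwards [hae] with x hx
  have hx' : u x = 0 := by
    rcases lt_trichotomy (u x) 0 with h | h | h
    · simp [ENNReal.ofReal_of_nonpos h.le] at hx
      linarith
    · exact h
    · have : ENNReal.ofReal (-u x) = 0 := ENNReal.ofReal_of_nonpos (by linarith)
      simp only [Pi.neg_apply] at hx
      rw [this, ENNReal.ofReal_eq_zero] at hx
      linarith
  simpa [hu_def, Real.exp_ne_zero] using hx'

end Injectivity

/-! ### Chambers -/

variable {V : Type*} [NormedAddCommGroup V] [NormedSpace ℝ V]
  {Δ : Finset V} {δ : Set (StrongDual ℝ V)} {r : ℕ}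

lemma isOpen_dualReg (Δ : Finset V) : IsOpen (dualReg Δ) := by
  have : dualReg Δ = ⋂ α ∈ Δ, {y : StrongDual ℝ V | y α ≠ 0} := by
    ext y
    simp [dualReg]
  rw [this]
  exact isOpen_biInter_finset fun α _ =>
    isOpen_ne_fun (by fun_prop) continuous_const

lemma IsDualChamber.isOpen (hδ : IsDualChamber Δ δ) : IsOpen δ := by
  obtain ⟨y, -, rfl⟩ := hδ
  exact (isOpen_dualReg Δ).connectedComponentIn

lemma IsDualChamber.nonempty (hδ : IsDualChamber Δ δ) : δ.Nonempty := by
  obtain ⟨y, hy, rfl⟩ := hδ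
  exact ⟨y, mem_connectedComponentIn hy⟩

lemma IsDualChamber.subset (hδ : IsDualChamber Δ δ) : δ ⊆ dualReg Δ := by
  obtain ⟨y, -, rfl⟩ := hδ
  exact connectedComponentIn_subset _ _

/-- An element of `Δ` which is positive at one point of a chamber is positive on the chamber. -/
lemma IsDualChamber.pos_of_pos (hδ : IsDualChamber Δ δ) {α : V} (hα : α ∈ Δ)
    {y₀ : StrongDual ℝ V} (hy₀ : y₀ ∈ δ) (h₀ : 0 < y₀ α) : ∀ y ∈ δ, 0 < y α := by
  intro y hy
  by_contra! hneg
  have hsub := hδ.subset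
  have hpre : IsPreconnected δ := by
    obtain ⟨y, -, rfl⟩ := hδ
    exact isPreconnected_connectedComponentIn
  have hc : ContinuousOn (fun y : StrongDual ℝ V => y α) δ := by fun_prop
  obtain ⟨w, hw, hw0⟩ := hpre.intermediate_value hy hy₀ hc ⟨hneg, h₀.le⟩
  exact hsub hw α hα hw0

/-! ### Rational functions with poles on the hyperplanes of `Δ`, and the identity theorem. -/

/-- A function on `V*` which becomes analytic on `V*` after multiplication by a product of
powers of elements of `Δ`. -/
def IsAnalyticUpToPoles (Δ : Finset V) (φ : StrongDual ℝ V → ℝ) : Prop :=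
  ∃ (N : ℕ) (q : StrongDual ℝ V → ℝ), AnalyticOnNhd ℝ q univ ∧
    ∀ y ∈ dualReg Δ, φ y * ∏ α ∈ Δ, y α ^ N = q y

lemma analyticOnNhd_eval_pow (α : V) (N : ℕ) :
    AnalyticOnNhd ℝ (fun y : StrongDual ℝ V => y α ^ N) univ :=
  ((ContinuousLinearMap.apply ℝ ℝ α).analyticOnNhd univ).pow N

lemma analyticOnNhd_prod_pow (Δ : Finset V) (N : V → ℕ) :
    AnalyticOnNhd ℝ (fun y : StrongDual ℝ V => ∏ α ∈ Δ, y α ^ N α) univ :=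
  Finset.analyticOnNhd_fun_prod _ fun α _ => analyticOnNhd_eval_pow α (N α)

lemma IsAnalyticUpToPoles.zero : IsAnalyticUpToPoles Δ 0 :=
  ⟨0, 0, analyticOnNhd_const, by simp⟩

lemma IsAnalyticUpToPoles.add {φ ψ : StrongDual ℝ V → ℝ} (hφ : IsAnalyticUpToPoles Δ φ)
    (hψ : IsAnalyticUpToPoles Δ ψ) : IsAnalyticUpToPoles Δ (φ + ψ) := by
  obtain ⟨N, q, hq, h⟩ := hφ
  obtain ⟨M, p, hp, h'⟩ := hψ
  refine ⟨N + M, fun y => q y * ∏ α ∈ Δ, y α ^ M + p y * ∏ α ∈ Δ, y α ^ N,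
    (hq.mul (analyticOnNhd_prod_pow Δ _)).add (hp.mul (analyticOnNhd_prod_pow Δ _)), ?_⟩
  intro y hy
  simp only [← h y hy, ← h' y hy, pow_add, Finset.prod_mul_distrib, Pi.add_apply]
  ring

lemma IsAnalyticUpToPoles.smul {φ : StrongDual ℝ V → ℝ} (hφ : IsAnalyticUpToPoles Δ φ) (a : ℝ) :
    IsAnalyticUpToPoles Δ (a • φ) := by
  obtain ⟨N, q, hq, h⟩ := hφ
  refine ⟨N, fun y => a * q y, analyticOnNhd_const.mul hq, ?_⟩
  intro y hy
  simp only [← h y hy, Pi.smul_apply, smul_eq_mul]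
  ring

lemma isAnalyticUpToPoles_inv_prod {κ : Finset V} (hκ : κ ⊆ Δ) (n : V → ℕ) :
    IsAnalyticUpToPoles Δ fun y => (∏ α ∈ κ, y α ^ n α)⁻¹ := by
  classical
  -- The sum of the `n α` is a common exponent that dominates each of them, so the subtraction below
  -- is never truncated.
  refine ⟨∑ α ∈ κ, n α, fun y => (∏ α ∈ κ, y α ^ (∑ β ∈ κ, n β - n α)) *
    ∏ α ∈ Δ \ κ, y α ^ (∑ β ∈ κ, n β),
    (analyticOnNhd_prod_pow κ _).mul (analyticOnNhd_prod_pow _ fun _ => ∑ β ∈ κ, n β), ?_⟩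
  intro y hy
  rw [← Finset.prod_sdiff hκ, mul_comm (∏ α ∈ Δ \ κ, _), ← mul_assoc]
  congr 1
  rw [inv_mul_eq_iff_eq_mul₀ (Finset.prod_ne_zero_iff.2 fun α hα => pow_ne_zero _ (hy α (hκ hα))),
    ← Finset.prod_mul_distrib]
  refine Finset.prod_congr rfl fun α hα => ?_
  rw [← pow_add, Nat.add_sub_cancel' (Finset.single_le_sum (fun _ _ => Nat.zero_le _) hα)]

/-- The identity theorem for rational functions with poles on the hyperplanes of `Δ`. -/
lemma IsAnalyticUpToPoles.eqOn_zero {φ : StrongDual ℝ V → ℝ} (hφ : IsAnalyticUpToPoles Δ φ)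
    (hδ : IsDualChamber Δ δ) (h : ∀ y ∈ δ, φ y = 0) : ∀ y ∈ dualReg Δ, φ y = 0 := by
  obtain ⟨N, q, hq, hqφ⟩ := hφ
  obtain ⟨y₀, hy₀⟩ := hδ.nonempty
  have hq0 : EqOn q 0 univ := by
    refine hq.eqOn_zero_of_preconnected_of_eventuallyEq_zero isPreconnected_univ (mem_univ y₀) ?_
    filter_upwards [hδ.isOpen.mem_nhds hy₀] with y hy
    rw [← hqφ y (hδ.subset hy), h y hy, zero_mul, Pi.zero_apply]
  intro y hy
  have := hqφ y hy
  rw [hq0 (mem_univ y), Pi.zero_apply, mul_eq_zero] at this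
  exact this.resolve_right
    (Finset.prod_ne_zero_iff.2 fun α hα => pow_ne_zero _ (hy α hα))

end

section

open scoped Nat

variable {V : Type*} [NormedAddCommGroup V] [NormedSpace ℝ V]
  {Δ : Finset V} {δ : Set (StrongDual ℝ V)} {r : ℕ}

/-! ### Walls -/

lemma finite_setOf_isWall (Δ : Finset V) : {W : Submodule ℝ V | IsWall Δ W}.Finite := by
  refine ((Δ.powerset.finite_toSet).image
    fun s : Finset V => Submodule.span ℝ (s : Set V)).subset ?_
  rintro W ⟨s, hs, -, -, rfl⟩
  exact ⟨s, by simpa using hs, rfl⟩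

/-- The finite set of all walls. -/
def walls (Δ : Finset V) : Finset (Submodule ℝ V) := (finite_setOf_isWall Δ).toFinset

lemma mem_walls {W : Submodule ℝ V} : W ∈ walls Δ ↔ IsWall Δ W := by simp [walls]

lemma IsWall.finrank_add_one [FiniteDimensional ℝ V] {W : Submodule ℝ V} (hW : IsWall Δ W) :
    finrank ℝ W + 1 = finrank ℝ V := by
  obtain ⟨s, -, hs, hcard, rfl⟩ := hW
  rw [← hcard, finrank_span_set_eq_card hs]
  simp

lemma IsWall.ne_top [FiniteDimensional ℝ V] {W : Submodule ℝ V} (hW : IsWall Δ W) : W ≠ ⊤ := by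
  rintro rfl
  have := hW.finrank_add_one
  rw [finrank_top] at this
  omega

lemma finrank_ker_add_one {z : StrongDual ℝ V} [FiniteDimensional ℝ V] (hz : z ≠ 0) :
    finrank ℝ (LinearMap.ker (z : V →ₗ[ℝ] ℝ)) + 1 = finrank ℝ V :=
  Module.Dual.finrank_ker_add_one_of_ne_zero fun h => hz (by ext x; exact LinearMap.congr_fun h x)

lemma IsWall.exists_eq_ker [FiniteDimensional ℝ V] {W : Submodule ℝ V} (hW : IsWall Δ W) :
    ∃ z : StrongDual ℝ V, z ≠ 0 ∧ W = LinearMap.ker (z : V →ₗ[ℝ] ℝ) := by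
  obtain ⟨f, hf, hle⟩ := W.exists_le_ker_of_lt_top hW.ne_top.lt_top
  have hz : LinearMap.toContinuousLinearMap f ≠ 0 := by simpa using hf
  refine ⟨LinearMap.toContinuousLinearMap f, hz, ?_⟩
  refine Submodule.eq_of_le_of_finrank_eq (by simpa using hle) ?_
  have := hW.finrank_add_one
  have := finrank_ker_add_one hz
  omega

lemma ne_zero_of_isWall_ker [FiniteDimensional ℝ V] {z : StrongDual ℝ V}
    (hW : IsWall Δ (LinearMap.ker (z : V →ₗ[ℝ] ℝ))) : z ≠ 0 := by
  rintro rfl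
  exact hW.ne_top (by simp)

/-- The hyperplane where the `i`-th coordinate vanishes is spanned by the other vectors of `b`.
Hence the singularities of `genFun b m` lie on walls. -/
lemma isWall_ker_coord (b : Basis (Fin r) ℝ V) (hb : ∀ i, b i ∈ Δ) (i : Fin r) :
    IsWall Δ (LinearMap.ker (b.coord i)) := by
  classical
  refine ⟨(Finset.univ.erase i).image b, ?_, ?_, ?_, ?_⟩
  · intro x hx
    obtain ⟨j, -, rfl⟩ := Finset.mem_image.1 hx
    exact hb j
  · rw [Finset.coe_image]
    exact (b.linearIndependent.linearIndepOn _).id_image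
  · rw [Finset.card_image_of_injective _ b.injective, Finset.card_erase_of_mem (Finset.mem_univ i),
      Finset.card_univ, ← finrank_eq_card_basis b]
    have : 0 < Fintype.card (Fin r) := Fintype.card_pos_iff.2 ⟨i⟩
    rw [← finrank_eq_card_basis b] at this
    omega
  · ext x
    rw [Finset.coe_image, b.mem_span_image, LinearMap.mem_ker, Basis.coord_apply]
    constructor
    · intro h j hj
      have : j ≠ i := by
        rintro rfl
        simp [h] at hj
      simpa using this
    · intro h
      by_contra hne
      have := h (Finsupp.mem_support_iff.2 hne)
      simp at this

lemma repr_ne_zero_of_mem_reg (b : Basis (Fin r) ℝ V) (hb : ∀ i, b i ∈ Δ) {h : V}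
    (hh : h ∈ reg Δ) (i : Fin r) : b.repr h i ≠ 0 :=
  hh _ (isWall_ker_coord b hb i)

lemma isOpen_compl_submodule [FiniteDimensional ℝ V] (W : Submodule ℝ V) :
    IsOpen (W : Set V)ᶜ :=
  W.closed_of_finiteDimensional.isOpen_compl

lemma isOpen_reg [FiniteDimensional ℝ V] (Δ : Finset V) : IsOpen (reg Δ) := by
  have : reg Δ = ⋂ W ∈ walls Δ, (W : Set V)ᶜ := by
    ext h
    simp [reg, mem_walls]
  rw [this]
  exact isOpen_biInter_finset fun W _ => isOpen_compl_submodule W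

lemma isOpen_regAlong [FiniteDimensional ℝ V] (Δ : Finset V) (V₀ : Submodule ℝ V) :
    IsOpen (regAlong Δ V₀) := by
  classical
  have : regAlong Δ V₀ = ⋂ W ∈ (walls Δ).erase V₀, (W : Set V)ᶜ := by
    ext h
    simp only [regAlong, mem_ofPred_eq, Finset.mem_erase, mem_walls, mem_iInter, mem_compl_iff,
      SetLike.mem_coe]
    tauto
  rw [this]
  exact isOpen_biInter_finset fun W _ => isOpen_compl_submodule W

lemma ae_notMem_submodule [FiniteDimensional ℝ V] [MeasurableSpace V] [BorelSpace V]
    [Fact (finrank ℝ V = r)] (ω : V [⋀^Fin r]→ₗ[ℝ] ℝ) {W : Submodule ℝ V} (hW : W ≠ ⊤) :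
    ∀ᵐ h ∂ω.measure, h ∉ W := by
  rw [measure_eq_smul_addHaar ω (finBasisOfFinrankEq ℝ V Fact.out)]
  refine Measure.ae_smul_measure ?_ _
  exact measure_eq_zero_iff_ae_notMem.1 (Measure.addHaar_submodule _ W hW)

lemma ae_mem_reg [FiniteDimensional ℝ V] [MeasurableSpace V] [BorelSpace V]
    [Fact (finrank ℝ V = r)] (ω : V [⋀^Fin r]→ₗ[ℝ] ℝ) (Δ : Finset V) :
    ∀ᵐ h ∂ω.measure, h ∈ reg Δ := by
  have : ∀ᵐ h ∂ω.measure, ∀ W ∈ {W : Submodule ℝ V | IsWall Δ W}, h ∉ W :=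
    (ae_ball_iff (finite_setOf_isWall Δ).countable).2
      fun W hW => ae_notMem_submodule ω (IsWall.ne_top hW)
  exact this

lemma dense_compl_submodule [FiniteDimensional ℝ V] {W : Submodule ℝ V} (hW : W ≠ ⊤) :
    Dense (W : Set V)ᶜ := by
  rw [← interior_eq_empty_iff_dense_compl, ← not_nonempty_iff_eq_empty]
  exact fun h => hW (W.eq_top_of_nonempty_interior' h)

lemma dense_reg [FiniteDimensional ℝ V] (Δ : Finset V) : Dense (reg Δ) := by
  have : reg Δ = ⋂ W ∈ {W : Submodule ℝ V | IsWall Δ W}, (W : Set V)ᶜ := by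
    ext h
    simp [reg]
  rw [this]
  exact dense_biInter_of_isOpen (fun W _ => isOpen_compl_submodule W)
    (finite_setOf_isWall Δ).countable fun W hW => dense_compl_submodule (IsWall.ne_top hW)

/-! ### Locally polynomial functions are given by formal combinations -/

lemma mem_cone_image_basis [DecidableEq V] (b : Basis (Fin r) ℝ V) (h : V) :
    h ∈ cone (Finset.univ.image b) ↔ ∀ i, 0 ≤ b.repr h i := by
  have hcoe : ((Finset.univ.image b : Finset V) : Set V) = range b := by simp
  unfold cone
  rw [hcoe, SetLike.mem_coe]
  constructor
  · intro hh i
    induction hh using Submodule.span_induction with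
    | mem x hx =>
      obtain ⟨j, rfl⟩ := hx
      rw [b.repr_self, Finsupp.single_apply]
      split_ifs <;> simp
    | zero => simp
    | add x y _ _ hx hy =>
      rw [map_add, Finsupp.add_apply]
      exact add_nonneg hx hy
    | smul a x _ hx =>
      have : a • x = (a : ℝ) • x := rfl
      rw [this, map_smul, Finsupp.smul_apply]
      exact mul_nonneg a.2 hx
  · intro hh
    rw [← b.sum_repr h]
    refine Submodule.sum_mem _ fun i _ => ?_
    exact Submodule.smul_mem _ (⟨b.repr h i, hh i⟩ : NNReal)
      (Submodule.subset_span (mem_range_self i))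

/-- The open and the closed cone of `b` differ only where a coordinate vanishes, that is, on walls.
-/
lemma genFun_eq_indicator [DecidableEq V] (b : Basis (Fin r) ℝ V) (hb : ∀ i, b i ∈ Δ)
    (m : Fin r → ℕ) {h : V} (hh : h ∈ reg Δ) :
    genFun b m h = (cone (Finset.univ.image b)).indicator (fun h => ∏ i, b.repr h i ^ m i) h := by
  have hne := repr_ne_zero_of_mem_reg b hb hh
  by_cases hc : h ∈ cone (Finset.univ.image b)
  · rw [indicator_of_mem hc]
    rw [mem_cone_image_basis] at hc
    exact Finset.prod_congr rfl fun i _ => truncPow_of_pos ((hc i).lt_of_ne' (hne i))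
  · rw [indicator_of_notMem hc]
    rw [mem_cone_image_basis] at hc
    push Not at hc
    obtain ⟨i, hi⟩ := hc
    exact Finset.prod_eq_zero (Finset.mem_univ i) (truncPow_of_nonpos hi.le)

lemma coord_mem_polyFun (b : Basis (Fin r) ℝ V) (i : Fin r) :
    (fun h => b.repr h i) ∈ polyFun V := by
  have := b.finiteDimensional_of_finite
  exact Algebra.subset_adjoin ⟨LinearMap.toContinuousLinearMap (b.coord i), rfl⟩

/-- The restriction of `fn c` to the regular elements is locally polynomial. -/
lemma fn_mem_locPoly (c : Comb Δ δ r) :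
    (fun h : reg Δ => fn c (h : V)) ∈ locPoly Δ δ := by
  classical
  induction c using Comb.induction with
  | zero => rw [map_zero]; exact (locPoly Δ δ).zero_mem
  | add c d hc hd => rw [map_add]; exact (locPoly Δ δ).add_mem hc hd
  | smul a c hc => rw [map_smul]; exact (locPoly Δ δ).smul_mem a hc
  | single b m =>
    refine Submodule.subset_span ⟨fun h => ∏ i, b.basis.repr h i ^ m i, ?_,
      Finset.univ.image b.basis, ?_, ?_, ?_, ?_, ?_⟩
    · have : (fun h => ∏ i, b.basis.repr h i ^ m i) =
          ∏ i, (fun h => b.basis.repr h i) ^ m i := by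
        ext h
        simp
      rw [this]
      exact prod_mem fun i _ => pow_mem (coord_mem_polyFun b.basis i) _
    · intro x hx
      obtain ⟨j, -, rfl⟩ := Finset.mem_image.1 hx
      exact b.mem j
    · rw [Finset.coe_image]
      exact (b.basis.linearIndependent.linearIndepOn _).id_image
    · simp [b.basis.span_eq]
    · intro h hh y hy
      rw [mem_cone_image_basis] at hh
      rw [← b.basis.sum_repr h, map_sum]
      refine Finset.sum_nonneg fun i _ => ?_
      rw [map_smul]
      exact mul_nonneg (hh i) (b.pos i y hy).le
    · funext h
      rw [fn_single, one_smul, genFun_eq_indicator b.basis b.mem m h.2]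

/-- A linearly independent generating finite set, as a basis indexed by `Fin r`. -/
lemma exists_basis_of_finset (hr : finrank ℝ V = r) {σ : Finset V}
    (hli : LinearIndepOn ℝ id (σ : Set V)) (hsp : Submodule.span ℝ (σ : Set V) = ⊤) :
    ∃ (b : Basis (Fin r) ℝ V) (e : Fin r ≃ σ), ∀ i, b i = e i := by
  let b₀ : Basis σ ℝ V := Basis.mk (v := fun x : σ => (x : V)) hli (by
    rw [← hsp]
    exact Submodule.span_mono fun x hx => ⟨⟨x, hx⟩, rfl⟩)
  have hcard : Fintype.card σ = r := by rw [← finrank_eq_card_basis b₀, hr]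
  let e := (Fintype.equivFinOfCardEq hcard).symm
  refine ⟨b₀.reindex e.symm, e, fun i => ?_⟩
  rw [Basis.reindex_apply, Equiv.symm_symm]
  exact Basis.mk_apply ..

lemma exists_mvPolynomial_of_mem_polyFun (b : Basis (Fin r) ℝ V) {f : V → ℝ}
    (hf : f ∈ polyFun V) :
    ∃ p : MvPolynomial (Fin r) ℝ, ∀ h, f h = MvPolynomial.eval (fun i => b.repr h i) p := by
  induction hf using Algebra.adjoin_induction with
  | mem f hf =>
    obtain ⟨l, rfl⟩ := hf
    refine ⟨∑ i, MvPolynomial.C (l (b i)) * MvPolynomial.X i, fun h => ?_⟩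
    have : l h = ∑ i, l (b i) * b.repr h i := by
      conv_lhs => rw [← b.sum_repr h, map_sum]
      simp [mul_comm]
    simpa using this
  | algebraMap a => exact ⟨MvPolynomial.C a, fun h => by simp⟩
  | add f g _ _ hf hg =>
    obtain ⟨p, hp⟩ := hf
    obtain ⟨q, hq⟩ := hg
    exact ⟨p + q, fun h => by simp [hp, hq]⟩
  | mul f g _ _ hf hg =>
    obtain ⟨p, hp⟩ := hf
    obtain ⟨q, hq⟩ := hg
    exact ⟨p * q, fun h => by simp [hp, hq]⟩

/-- A polynomial is expanded into monomials in the coordinates of the basis `σ`. The inclusion `C(σ)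
⊆ δ^∨` gives `y (b i) ≥ 0` on `δ`, and regularity of the points of `δ` makes this strict. -/
lemma exists_fn_of_mem_locPoly (hr : finrank ℝ V = r) (hδ : IsDualChamber Δ δ)
    {f : reg Δ → ℝ} (hf : f ∈ locPoly Δ δ) :
    ∃ c : Comb Δ δ r, ∀ h : reg Δ, f h = fn c (h : V) := by
  classical
  induction hf using Submodule.span_induction with
  | mem f hf =>
    obtain ⟨P, hP, σ, hσ, hli, hsp, hcone, rfl⟩ := hf
    obtain ⟨b, e, hb⟩ := exists_basis_of_finset hr hli hsp
    have hmem : ∀ i, b i ∈ Δ := fun i => by rw [hb]; exact hσ (e i).2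
    have himage : Finset.univ.image b = σ := by
      ext x
      simp only [Finset.mem_image, Finset.mem_univ, true_and, hb]
      exact ⟨by rintro ⟨i, rfl⟩; exact (e i).2, fun hx => ⟨e.symm ⟨x, hx⟩, by simp⟩⟩
    obtain ⟨p, hp⟩ := exists_mvPolynomial_of_mem_polyFun b hP
    let B : PosBasis Δ δ r := ⟨b, hmem, fun i y hy => by
      have h0 : b i ∈ cone σ := by
        rw [← himage, mem_cone_image_basis]
        intro j
        rw [b.repr_self, Finsupp.single_apply]
        split_ifs <;> simp
      exact (hcone h0 y hy).lt_of_ne' (hδ.subset hy _ (hmem i))⟩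
    refine ⟨∑ d ∈ p.support, Finsupp.single (B, ⇑d) (p.coeff d), fun h => ?_⟩
    simp only [map_sum, fn_single, Finset.sum_apply, Pi.smul_apply, smul_eq_mul]
    simp only [B, genFun_eq_indicator b hmem _ h.2, himage]
    by_cases hc : (h : V) ∈ cone σ
    · simp only [indicator_of_mem hc, hp, MvPolynomial.eval_eq']
    · simp [indicator_of_notMem hc]
  | zero => exact ⟨0, by simp⟩
  | add f g _ _ hf hg =>
    obtain ⟨c, hc⟩ := hf
    obtain ⟨d, hd⟩ := hg
    exact ⟨c + d, fun h => by simp [hc, hd]⟩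
  | smul a f _ hf =>
    obtain ⟨c, hc⟩ := hf
    exact ⟨a • c, fun h => by simp [hc]⟩

/-! ### Partial fractions -/

lemma genLap_eq_smul_inv_prod (ω : V [⋀^Fin r]→ₗ[ℝ] ℝ) (b : Basis (Fin r) ℝ V)
    (m : Fin r → ℕ) (y : StrongDual ℝ V) :
    genLap ω b m y = (|ω b| * ∏ i, ((m i)! : ℝ)) * (∏ i, y (b i) ^ (m i + 1))⁻¹ := by
  rw [genLap, Finset.prod_div_distrib, mul_assoc, div_eq_mul_inv]

lemma isAnalyticUpToPoles_lap (ω : V [⋀^Fin r]→ₗ[ℝ] ℝ) (c : Comb Δ δ r) :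
    IsAnalyticUpToPoles Δ (lap ω c) := by
  classical
  induction c using Comb.induction with
  | zero => rw [map_zero]; exact .zero
  | add c d hc hd => rw [map_add]; exact hc.add hd
  | smul a c hc => rw [map_smul]; exact hc.smul a
  | single b m =>
    have hκ : Finset.univ.image b.basis ⊆ Δ := by
      intro x hx
      obtain ⟨j, -, rfl⟩ := Finset.mem_image.1 hx
      exact b.mem j
    have := (isAnalyticUpToPoles_inv_prod hκ
      (Function.extend b.basis (fun i => m i + 1) 0)).smul (|ω b.basis| * ∏ i, ((m i)! : ℝ))
    convert this using 1
    funext y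
    rw [lap_single, one_smul, genLap_eq_smul_inv_prod, Pi.smul_apply,
      Finset.prod_image b.basis.injective.injOn]
    simp [b.basis.injective.extend_apply]

/-- A simple fraction with linearly independent poles is a Laplace transform. -/
lemma exists_lap_eq_inv_prod_of_linearIndepOn (hr : finrank ℝ V = r) (hδ : IsDualChamber Δ δ)
    (hneg : ∀ α ∈ Δ, -α ∈ Δ) {ω : V [⋀^Fin r]→ₗ[ℝ] ℝ} (hω : ω ≠ 0) {κ : Finset V} (hκ : κ ⊆ Δ)
    (hli : LinearIndepOn ℝ id (κ : Set V)) (hsp : Submodule.span ℝ (κ : Set V) = ⊤)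
    {n : V → ℕ} (hn : ∀ α ∈ κ, 0 < n α) :
    ∃ c : Comb Δ δ r, ∀ y : StrongDual ℝ V, lap ω c y = (∏ α ∈ κ, y α ^ n α)⁻¹ := by
  obtain ⟨y₀, hy₀⟩ := hδ.nonempty
  obtain ⟨b₀, e, hb₀⟩ := exists_basis_of_finset hr hli hsp
  have hmem₀ : ∀ i, b₀ i ∈ Δ := fun i => by rw [hb₀]; exact hκ (e i).2
  -- Each basis vector is replaced by its negative when needed, so that all are positive on `δ`;
  -- this uses `Δ = -Δ`.
  let ε : Fin r → ℝˣ := fun i => if 0 < y₀ (b₀ i) then 1 else -1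
  let b := b₀.unitsSMul ε
  have hb : ∀ i, b i = (ε i : ℝ) • b₀ i := fun i => by
    simp only [b, Basis.unitsSMul_apply, Units.smul_def]
  have hmem : ∀ i, b i ∈ Δ := fun i => by
    rw [hb]
    simp only [ε]
    split_ifs
    · simpa using hmem₀ i
    · simpa using hneg _ (hmem₀ i)
  have hpos₀ : ∀ i, 0 < y₀ (b i) := fun i => by
    rw [hb, map_smul]
    have := hδ.subset hy₀ _ (hmem₀ i)
    simp only [ε]
    split_ifs with h
    · simpa using h
    · simpa using lt_of_le_of_ne (not_lt.1 h) this
  let B : PosBasis Δ δ r := ⟨b, hmem, fun i => hδ.pos_of_pos (hmem i) hy₀ (hpos₀ i)⟩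
  let m : Fin r → ℕ := fun i => n (b₀ i) - 1
  have hm : ∀ i, m i + 1 = n (b₀ i) := fun i =>
    Nat.sub_add_cancel (hn _ (by rw [hb₀]; exact (e i).2))
  -- `K` is the ratio of the transform of the monomial on the cone of `b` to the wanted fraction:
  -- factorials and volume, times the signs from `b i = ε i • b₀ i`.
  set K : ℝ := (|ω b| * ∏ i, ((m i)! : ℝ)) * (∏ i, (ε i : ℝ) ^ n (b₀ i))⁻¹ with hK
  have hωb : ω b ≠ 0 := (ω.map_basis_ne_zero_iff b).2 hω
  have hK0 : K ≠ 0 := by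
    refine mul_ne_zero (mul_ne_zero (abs_ne_zero.2 hωb) ?_) (inv_ne_zero ?_)
    · exact Finset.prod_ne_zero_iff.2 fun i _ => by positivity
    · exact Finset.prod_ne_zero_iff.2 fun i _ => pow_ne_zero _ (ε i).ne_zero
  refine ⟨Finsupp.single (B, m) K⁻¹, fun y => ?_⟩
  rw [lap_single, Pi.smul_apply, genLap_eq_smul_inv_prod]
  have h1 : ∏ i, y (B.basis i) ^ (m i + 1) =
      (∏ i, (ε i : ℝ) ^ n (b₀ i)) * ∏ α ∈ κ, y α ^ n α := by
    rw [← Finset.prod_coe_sort κ, ← e.prod_comp, ← Finset.prod_mul_distrib]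
    refine Finset.prod_congr rfl fun i _ => ?_
    rw [hm, ← hb₀, ← mul_pow]
    congr 1
    change y (b i) = _
    rw [hb, map_smul, smul_eq_mul]
  rw [h1, mul_inv (∏ i, _), ← mul_assoc, smul_eq_mul]
  exact inv_mul_cancel_left₀ hK0 _

/-- Partial fractions: the functions in `G Δ` are Laplace transforms. -/
lemma exists_lap_eq_inv_prod (hr : finrank ℝ V = r) (hδ : IsDualChamber Δ δ)
    (hneg : ∀ α ∈ Δ, -α ∈ Δ) {ω : V [⋀^Fin r]→ₗ[ℝ] ℝ} (hω : ω ≠ 0) (κ : Finset V) :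
    κ ⊆ Δ → Submodule.span ℝ (κ : Set V) = ⊤ → ∀ n : V → ℕ, (∀ α ∈ κ, 0 < n α) →
    ∃ c : Comb Δ δ r, ∀ y ∈ dualReg Δ, lap ω c y = (∏ α ∈ κ, y α ^ n α)⁻¹ := by
  classical
  induction κ using Finset.strongInduction with
  | H κ ih =>
  intro hκ hsp
  by_cases hli : LinearIndepOn ℝ id (κ : Set V)
  · intro n hn
    obtain ⟨c, hc⟩ := exists_lap_eq_inv_prod_of_linearIndepOn hr hδ hneg hω hκ hli hsp hn
    exact ⟨c, fun y _ => hc y⟩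
  -- A relation `β = ∑ a α • α` gives `1 = ∑ a α * y α / y β`. Multiplying the fraction by it yields
  -- terms in which one exponent `n α` drops by one and `n β` rises by one.
  obtain ⟨β, hβ, hβsp⟩ : ∃ β ∈ κ, β ∈ Submodule.span ℝ ((κ.erase β : Finset V) : Set V) := by
    rw [linearIndepOn_iff_notMem_span] at hli
    push Not at hli
    obtain ⟨β, hβ, h⟩ := hli
    exact ⟨β, hβ, by simpa using h⟩
  obtain ⟨a, -, ha⟩ := Submodule.mem_span_finset.1 hβsp
  -- The inner induction is on the sum of the exponents other than that of `β`, which each such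
  -- exchange lowers.
  suffices H : ∀ N : ℕ, ∀ n : V → ℕ, (∀ α ∈ κ, 0 < n α) → ∑ α ∈ κ.erase β, n α = N →
      ∃ c : Comb Δ δ r, ∀ y ∈ dualReg Δ, lap ω c y = (∏ α ∈ κ, y α ^ n α)⁻¹ from
    fun n hn => H _ n hn rfl
  intro N
  induction N using Nat.strong_induction_on with
  | _ N ihN =>
  intro n hn hN
  have key : ∀ α ∈ κ.erase β, ∃ c : Comb Δ δ r, ∀ y ∈ dualReg Δ,
      lap ω c y = a α * (y α / y β * (∏ α ∈ κ, y α ^ n α)⁻¹) := by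
    intro α hα
    by_cases ha0 : a α = 0
    · exact ⟨0, fun y _ => by simp [ha0]⟩
    have hαβ : α ≠ β := (Finset.mem_erase.1 hα).1
    have hακ : α ∈ κ := (Finset.mem_erase.1 hα).2
    have hβα : β ∈ κ.erase α := Finset.mem_erase.2 ⟨hαβ.symm, hβ⟩
    have hsplit : ∀ y : StrongDual ℝ V, ∏ γ ∈ κ, y γ ^ n γ =
        y α ^ n α * (y β ^ n β * ∏ γ ∈ (κ.erase α).erase β, y γ ^ n γ) := fun y => by
      rw [← Finset.mul_prod_erase κ _ hακ, ← Finset.mul_prod_erase _ _ hβα]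
    have hcongr : ∀ (y : StrongDual ℝ V) (n' : V → ℕ), (∀ γ, γ ≠ α → γ ≠ β → n' γ = n γ) →
        ∏ γ ∈ (κ.erase α).erase β, y γ ^ n' γ = ∏ γ ∈ (κ.erase α).erase β, y γ ^ n γ :=
      fun y n' h => Finset.prod_congr rfl fun γ hγ => by
        simp only [Finset.mem_erase] at hγ
        rw [h γ hγ.2.1 hγ.1]
    by_cases h1 : n α = 1
    -- Here the pole `α` disappears. The set `κ.erase α` still spans, since `a α ≠ 0` lets the
    -- relation be solved for `α`; the outer induction on `κ` applies.
    · have hsp' : Submodule.span ℝ ((κ.erase α : Finset V) : Set V) = ⊤ := by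
        rw [eq_top_iff, ← hsp, Submodule.span_le]
        intro γ hγ
        by_cases hγα : γ = α
        · rw [hγα]
          have : a α • α = β - ∑ γ ∈ (κ.erase β).erase α, a γ • γ := by
            rw [eq_sub_iff_add_eq, Finset.add_sum_erase _ (fun γ => a γ • γ) hα, ha]
          have hα' : α = (a α)⁻¹ • (β - ∑ γ ∈ (κ.erase β).erase α, a γ • γ) := by
            rw [← this, inv_smul_smul₀ ha0]
          have hmem : (a α)⁻¹ • (β - ∑ γ ∈ (κ.erase β).erase α, a γ • γ) ∈
              Submodule.span ℝ ((κ.erase α : Finset V) : Set V) := by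
            refine Submodule.smul_mem _ _ (Submodule.sub_mem _ (Submodule.subset_span hβα)
              (Submodule.sum_mem _ fun γ hγ => Submodule.smul_mem _ _ (Submodule.subset_span ?_)))
            simp only [Finset.mem_erase] at hγ
            simp [hγ.1, hγ.2.2]
          rwa [← hα'] at hmem
        · exact Submodule.subset_span (by simpa [hγα] using hγ)
      obtain ⟨c, hc⟩ := ih (κ.erase α) (Finset.erase_ssubset hακ)
        ((Finset.erase_subset _ _).trans hκ) hsp' (Function.update n β (n β + 1)) (by
          intro γ hγ
          by_cases hγβ : γ = β
          · subst hγβ; simp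
          · rw [Function.update_of_ne hγβ]; exact hn γ (Finset.mem_of_mem_erase hγ))
      refine ⟨a α • c, fun y hy => ?_⟩
      have hyα := hy α (hκ hακ)
      have hyβ := hy β (hκ hβ)
      rw [map_smul, Pi.smul_apply, hc y hy, hsplit, ← Finset.mul_prod_erase _ _ hβα,
        hcongr y _ fun γ _ h => Function.update_of_ne h _ _, Function.update_self, smul_eq_mul, h1]
      congr 1
      rw [pow_succ]
      simp only [mul_inv, pow_one]
      field_simp
    · have hα1 : 0 < n α - 1 := by have := hn α hακ; omega
      obtain ⟨p, hp⟩ : ∃ p, n α = p + 1 := ⟨n α - 1, by omega⟩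
      set n' := Function.update (Function.update n β (n β + 1)) α (n α - 1) with hn'
      have hn'α : n' α = n α - 1 := Function.update_self ..
      have hn'β : n' β = n β + 1 := by
        rw [hn', Function.update_of_ne hαβ.symm, Function.update_self]
      have hn'γ : ∀ γ, γ ≠ α → γ ≠ β → n' γ = n γ := fun γ h h' => by
        rw [hn', Function.update_of_ne h, Function.update_of_ne h']
      have hlt : ∑ γ ∈ κ.erase β, n' γ < N := by
        rw [← hN]
        refine Finset.sum_lt_sum (fun γ hγ => ?_) ⟨α, hα, by rw [hn'α]; omega⟩
        by_cases hγα : γ = α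
        · rw [hγα, hn'α]; omega
        · rw [hn'γ γ hγα (Finset.mem_erase.1 hγ).1]
      obtain ⟨c, hc⟩ := ihN _ hlt n' (by
          intro γ hγ
          by_cases hγα : γ = α
          · rw [hγα, hn'α]; exact hα1
          by_cases hγβ : γ = β
          · rw [hγβ, hn'β]; omega
          · rw [hn'γ γ hγα hγβ]; exact hn γ hγ) rfl
      refine ⟨a α • c, fun y hy => ?_⟩
      have hyα := hy α (hκ hακ)
      have hyβ := hy β (hκ hβ)
      rw [map_smul, Pi.smul_apply, hc y hy, hsplit, ← Finset.mul_prod_erase κ _ hακ,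
        ← Finset.mul_prod_erase _ _ hβα, hcongr y _ hn'γ, hn'α, hn'β, smul_eq_mul, hp,
        Nat.add_sub_cancel]
      congr 1
      rw [pow_succ, pow_succ]
      simp only [mul_inv]
      field_simp
  choose! c hc using key
  refine ⟨∑ α ∈ κ.erase β, c α, fun y hy => ?_⟩
  have hyβ := hy β (hκ hβ)
  rw [map_sum, Finset.sum_apply, Finset.sum_congr rfl fun α hα => hc α hα y hy]
  have hsum : y β = ∑ α ∈ κ.erase β, a α * y α := by
    conv_lhs => rw [← ha, map_sum]
    simp
  calc ∑ α ∈ κ.erase β, a α * (y α / y β * (∏ α ∈ κ, y α ^ n α)⁻¹)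
      = (∑ α ∈ κ.erase β, a α * y α) / y β * (∏ α ∈ κ, y α ^ n α)⁻¹ := by
        rw [Finset.sum_div, Finset.sum_mul]
        exact Finset.sum_congr rfl fun α _ => by ring
    _ = _ := by rw [← hsum, div_self hyβ, one_mul]

lemma exists_lap_eq_of_mem_G (hr : finrank ℝ V = r) (hδ : IsDualChamber Δ δ)
    (hneg : ∀ α ∈ Δ, -α ∈ Δ) {ω : V [⋀^Fin r]→ₗ[ℝ] ℝ} (hω : ω ≠ 0) {f : dualReg Δ → ℝ}
    (hf : f ∈ G Δ) :
    ∃ c : Comb Δ δ r, ∀ y : dualReg Δ, lap ω c (y : StrongDual ℝ V) = f y := by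
  induction hf using Submodule.span_induction with
  | mem f hf =>
    obtain ⟨κ, n, hκ, hsp, hn, rfl⟩ := hf
    obtain ⟨c, hc⟩ := exists_lap_eq_inv_prod hr hδ hneg hω κ hκ hsp n hn
    exact ⟨c, fun y => hc y y.2⟩
  | zero => exact ⟨0, by simp⟩
  | add f g _ _ hf hg =>
    obtain ⟨c, hc⟩ := hf
    obtain ⟨d, hd⟩ := hg
    exact ⟨c + d, fun y => by simp [hc, hd]⟩
  | smul a f _ hf =>
    obtain ⟨c, hc⟩ := hf
    exact ⟨a • c, fun y => by simp [hc]⟩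

end

section

open scoped Nat

variable {V : Type*} [NormedAddCommGroup V] [NormedSpace ℝ V]
  {Δ : Finset V} {δ : Set (StrongDual ℝ V)} {r : ℕ}

/-! ### Behaviour at infinity of Laplace transforms -/

/-- The hyperplane `z = 0` is spanned by the vectors of `b` other than the `i`-th one. -/
def IsTransverse (z : StrongDual ℝ V) (b : Basis (Fin r) ℝ V) (i : Fin r) : Prop :=
  z (b i) ≠ 0 ∧ ∀ l, l ≠ i → z (b l) = 0

lemma IsTransverse.eq {z : StrongDual ℝ V} {b : Basis (Fin r) ℝ V} {i j : Fin r}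
    (h : IsTransverse z b i) (hj : z (b j) ≠ 0) : j = i := by
  by_contra hne
  exact hj (h.2 j hne)

lemma IsTransverse.apply_eq {z : StrongDual ℝ V} {b : Basis (Fin r) ℝ V} {i : Fin r}
    (h : IsTransverse z b i) (v : V) : z v = b.repr v i * z (b i) := by
  conv_lhs => rw [← b.sum_repr v, map_sum]
  rw [Finset.sum_eq_single i (fun l _ hl => by rw [map_smul, h.2 l hl, smul_zero])
    (fun hi => absurd (Finset.mem_univ i) hi), map_smul, smul_eq_mul]

lemma isTransverse_of_ker_coord_eq {z : StrongDual ℝ V} {b : Basis (Fin r) ℝ V} {i : Fin r}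
    (h : LinearMap.ker (b.coord i) = LinearMap.ker (z : V →ₗ[ℝ] ℝ)) : IsTransverse z b i := by
  refine ⟨fun h0 => ?_, fun l hl => ?_⟩
  · have : b i ∈ LinearMap.ker (b.coord i) := by rw [h]; exact h0
    simp at this
  · have : b l ∈ LinearMap.ker (z : V →ₗ[ℝ] ℝ) := by
      rw [← h]
      simp [hl]
    exact this

lemma IsTransverse.ker_eq {z : StrongDual ℝ V} {b : Basis (Fin r) ℝ V} {i : Fin r}
    (h : IsTransverse z b i) : LinearMap.ker (z : V →ₗ[ℝ] ℝ) = LinearMap.ker (b.coord i) := by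
  ext v
  simp [h.apply_eq v, h.1]

open Classical in
/-- The limit of `t * genLap ω b m (y + t • z)` as `|t| → ∞`. -/
def genBoundary (ω : V [⋀^Fin r]→ₗ[ℝ] ℝ) (z : StrongDual ℝ V) (b : Basis (Fin r) ℝ V)
    (m : Fin r → ℕ) (y : StrongDual ℝ V) : ℝ :=
  |ω b| * ∑ i, if IsTransverse z b i ∧ m i = 0 then
    (z (b i))⁻¹ * ∏ l ∈ Finset.univ.erase i, ((m l)! / y (b l) ^ (m l + 1) : ℝ) else 0

/-- The limit of `t * lap ω c (y + t • z)` as `|t| → ∞`. -/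
def boundary (ω : V [⋀^Fin r]→ₗ[ℝ] ℝ) (z : StrongDual ℝ V) :
    Comb Δ δ r →ₗ[ℝ] StrongDual ℝ V → ℝ :=
  Finsupp.linearCombination ℝ fun p => genBoundary ω z p.1.basis p.2

lemma boundary_single (ω : V [⋀^Fin r]→ₗ[ℝ] ℝ) (z : StrongDual ℝ V) (b : PosBasis Δ δ r)
    (m : Fin r → ℕ) (a : ℝ) :
    boundary ω z (Finsupp.single (b, m) a) = a • genBoundary ω z b.basis m :=
  Finsupp.linearCombination_single ..

lemma genBoundary_of_isTransverse (ω : V [⋀^Fin r]→ₗ[ℝ] ℝ) {z : StrongDual ℝ V}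
    {b : Basis (Fin r) ℝ V} {m : Fin r → ℕ} {i : Fin r} (h : IsTransverse z b i) (hm : m i = 0)
    (y : StrongDual ℝ V) :
    genBoundary ω z b m y = |ω b| * ((z (b i))⁻¹ *
      ∏ l ∈ Finset.univ.erase i, ((m l)! / y (b l) ^ (m l + 1) : ℝ)) := by
  rw [genBoundary, Finset.sum_eq_single i, if_pos ⟨h, hm⟩]
  · intro j _ hj
    exact if_neg fun hj' => hj (h.eq hj'.1.1)
  · exact fun hi => absurd (Finset.mem_univ i) hi

lemma genBoundary_of_forall_not (ω : V [⋀^Fin r]→ₗ[ℝ] ℝ) {z : StrongDual ℝ V}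
    {b : Basis (Fin r) ℝ V} {m : Fin r → ℕ} (h : ∀ i, IsTransverse z b i → m i ≠ 0)
    (y : StrongDual ℝ V) : genBoundary ω z b m y = 0 := by
  rw [genBoundary, Finset.sum_eq_zero, mul_zero]
  exact fun i _ => if_neg fun hi => h i hi.1 hi.2

lemma tendsto_add_mul_cobounded (a : ℝ) {w : ℝ} (hw : w ≠ 0) :
    Tendsto (fun t : ℝ => a + t * w) (Bornology.cobounded ℝ) (Bornology.cobounded ℝ) := by
  rw [← tendsto_norm_atTop_iff_cobounded]
  have h1 : Tendsto (fun t : ℝ => ‖t‖ * ‖w‖ - ‖a‖) (Bornology.cobounded ℝ) atTop :=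
    tendsto_atTop_add_const_right _ _
      (tendsto_norm_cobounded_atTop.atTop_mul_const (norm_pos_iff.2 hw))
  refine tendsto_atTop_mono (fun t => ?_) h1
  rw [← norm_mul, add_comm]
  have := norm_sub_norm_le (t * w) (-a)
  simpa using this

lemma tendsto_inv_add_mul (a : ℝ) {w : ℝ} (hw : w ≠ 0) :
    Tendsto (fun t : ℝ => (a + t * w)⁻¹) (Bornology.cobounded ℝ) (𝓝 0) :=
  tendsto_inv₀_cobounded.comp (tendsto_add_mul_cobounded a hw)

lemma eventually_cobounded_ne (x : ℝ) : ∀ᶠ t : ℝ in Bornology.cobounded ℝ, t ≠ x :=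
  (Metric.hasBasis_cobounded_compl_closedBall (0 : ℝ)).eventually_iff.2
    ⟨|x|, trivial, fun t ht h => ht (by simp [h])⟩

lemma eventually_add_mul_ne_zero (a : ℝ) {w : ℝ} (hw : w ≠ 0) :
    ∀ᶠ t : ℝ in Bornology.cobounded ℝ, a + t * w ≠ 0 :=
  (tendsto_add_mul_cobounded a hw).eventually (eventually_cobounded_ne 0)

lemma tendsto_mul_inv_add_mul (a : ℝ) {w : ℝ} (hw : w ≠ 0) :
    Tendsto (fun t : ℝ => t * (a + t * w)⁻¹) (Bornology.cobounded ℝ) (𝓝 w⁻¹) := by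
  have h := (tendsto_inv_add_mul a hw).const_mul a
  have h2 : Tendsto (fun t : ℝ => w⁻¹ * (1 - a * (a + t * w)⁻¹)) (Bornology.cobounded ℝ)
      (𝓝 (w⁻¹ * (1 - a * 0))) := (h.const_sub 1).const_mul _
  simp only [mul_zero, sub_zero, mul_one] at h2
  refine h2.congr' ?_
  filter_upwards [eventually_add_mul_ne_zero a hw] with t ht
  rw [inv_mul_eq_iff_eq_mul₀ hw]
  linear_combination (-1 : ℝ) * mul_inv_cancel₀ ht

lemma tendsto_factor (n : ℕ) (a w : ℝ) :
    Tendsto (fun t : ℝ => (n ! : ℝ) / (a + t * w) ^ (n + 1)) (Bornology.cobounded ℝ)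
      (𝓝 (if w = 0 then (n ! : ℝ) / a ^ (n + 1) else 0)) := by
  split_ifs with hw
  · simp [hw]
  · have := ((tendsto_inv_add_mul a hw).pow (n + 1)).const_mul (n ! : ℝ)
    simpa [div_eq_mul_inv] using this

lemma tendsto_mul_factor (n : ℕ) (a : ℝ) {w : ℝ} (hw : w ≠ 0) :
    Tendsto (fun t : ℝ => t * ((n ! : ℝ) / (a + t * w) ^ (n + 1))) (Bornology.cobounded ℝ)
      (𝓝 (if n = 0 then w⁻¹ else 0)) := by
  have h := ((tendsto_mul_inv_add_mul a hw).mul ((tendsto_inv_add_mul a hw).pow n)).const_mul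
    (n ! : ℝ)
  have e : (n ! : ℝ) * (w⁻¹ * 0 ^ n) = if n = 0 then w⁻¹ else 0 := by
    split_ifs with h
    · simp [h]
    · simp [h]
  rw [e] at h
  refine h.congr fun t => ?_
  rw [pow_succ, div_eq_mul_inv, mul_inv, inv_pow]
  ring

/-- Choose `i` with `z (b i) ≠ 0`. The factor `t` is absorbed by the `i`-th pole, with a nonzero
limit only if that pole is simple; any other factor with `z (b l) ≠ 0` tends to zero. What survives
is the case of a transverse `i` with `m i = 0`. -/
lemma tendsto_mul_lap (ω : V [⋀^Fin r]→ₗ[ℝ] ℝ) {z : StrongDual ℝ V} (hz : z ≠ 0)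
    (c : Comb Δ δ r) (y : StrongDual ℝ V) :
    Tendsto (fun t : ℝ => t * lap ω c (y + t • z)) (Bornology.cobounded ℝ)
      (𝓝 (boundary ω z c y)) := by
  induction c using Comb.induction with
  | zero => simp
  | add c d hc hd => simpa [mul_add] using hc.add hd
  | smul a c hc => simpa [mul_left_comm] using hc.const_mul a
  | single b m =>
    obtain ⟨i, hi⟩ : ∃ i, z (b.basis i) ≠ 0 := by
      by_contra! h
      exact hz (ContinuousLinearMap.coe_injective (b.basis.ext h))
    have h := ((tendsto_mul_factor (m i) (y (b.basis i)) hi).mul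
      (tendsto_finsetProd (Finset.univ.erase i) fun l _ =>
        tendsto_factor (m l) (y (b.basis l)) (z (b.basis l)))).const_mul |ω b.basis|
    have e : boundary ω z (Finsupp.single (b, m) 1) y = |ω b.basis| *
        ((if m i = 0 then (z (b.basis i))⁻¹ else 0) * ∏ l ∈ Finset.univ.erase i,
          if z (b.basis l) = 0 then ((m l)! : ℝ) / y (b.basis l) ^ (m l + 1) else 0) := by
      rw [boundary_single, one_smul]
      by_cases ht : IsTransverse z b.basis i
      · by_cases hm : m i = 0
        · rw [genBoundary_of_isTransverse ω ht hm, if_pos hm]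
          congr 2
          exact Finset.prod_congr rfl fun l hl => by
            rw [if_pos (ht.2 l (Finset.ne_of_mem_erase hl))]
        · rw [if_neg hm, zero_mul, mul_zero]
          refine genBoundary_of_forall_not ω (fun j hj => ?_) y
          rwa [← hj.eq hi]
      · have : ∃ l, l ≠ i ∧ z (b.basis l) ≠ 0 := by
          by_contra! h
          exact ht ⟨hi, h⟩
        obtain ⟨l, hl, hzl⟩ := this
        rw [Finset.prod_eq_zero (Finset.mem_erase.2 ⟨hl, Finset.mem_univ l⟩) (if_neg hzl),
          mul_zero, mul_zero]
        refine genBoundary_of_forall_not ω (fun j hj => ?_) y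
        rw [← hj.eq hi] at hj
        exact absurd hj ht
    rw [e]
    refine h.congr fun t => ?_
    rw [lap_single, one_smul, genLap, ← Finset.mul_prod_erase _ _ (Finset.mem_univ i)]
    simp only [add_apply, smul_apply, smul_eq_mul]
    ring

/-! ### Jumps across a hyperplane -/

/-- Only a factor with exponent `0` jumps where its coordinate vanishes. -/
lemma continuousAt_genFun (b : Basis (Fin r) ℝ V) (m : Fin r → ℕ) {w : V}
    (h : ∀ l, b.repr w l ≠ 0 ∨ 0 < m l) (s : Finset (Fin r)) :
    ContinuousAt (fun h => ∏ l ∈ s, truncPow (m l) (b.repr h l)) w := by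
  refine tendsto_finsetProd _ fun l _ => ?_
  have : ContinuousAt (truncPow (m l)) (b.repr w l) := by
    rcases h l with h | h
    · exact continuousAt_truncPow _ h
    · exact (continuous_truncPow_of_pos h).continuousAt
  exact ContinuousAt.comp (f := fun h => b.repr h l) this (continuous_repr b l).continuousAt

lemma map_update_basis (ω : V [⋀^Fin r]→ₗ[ℝ] ℝ) (b : Basis (Fin r) ℝ V) (i : Fin r) (β : V) :
    ω (Function.update b i β) = b.repr β i * ω b := by
  conv_lhs => rw [← b.sum_repr β, AlternatingMap.map_update_sum]
  rw [Finset.sum_eq_single i]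
  · rw [AlternatingMap.map_update_smul, Function.update_eq_self, smul_eq_mul]
  · intro l _ hl
    rw [AlternatingMap.map_update_smul, AlternatingMap.map_update_self _ _ hl.symm, smul_zero]
  · exact fun hi => absurd (Finset.mem_univ i) hi

lemma exists_basis_update (b : Basis (Fin r) ℝ V) {i : Fin r} {β : V} (h : b.repr β i ≠ 0) :
    ∃ b' : Basis (Fin r) ℝ V, ⇑b' = Function.update b i β := by
  have hdet : IsUnit (b.det (Function.update b i β)) := by
    rw [map_update_basis, b.det_self, mul_one]
    exact h.isUnit
  obtain ⟨h1, h2⟩ := (b.is_basis_iff_det).2 hdet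
  exact ⟨Basis.mk h1 h2.ge, Basis.coe_mk _ _⟩

/-- The jump of `fn c` across the hyperplane `z = 0` is, along lines parallel to `β`, the
function given by a combination whose Laplace transform is the leading coefficient at infinity in
the direction `z`. -/
lemma exists_jump (ω : V [⋀^Fin r]→ₗ[ℝ] ℝ) {z : StrongDual ℝ V} {β : V} (hβ : β ∈ Δ)
    (hpos : ∀ y ∈ δ, 0 < y β) (hzβ : z β ≠ 0) (c : Comb Δ δ r) :
    ∃ d : Comb Δ δ r,
      (∀ y ∈ dualReg Δ, lap ω d y = |z β| * boundary ω z c y / y β) ∧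
      (∀ h, z h / z β ≤ 0 → fn d h = 0) ∧
      ∀ w ∈ regAlong Δ (LinearMap.ker (z : V →ₗ[ℝ] ℝ)), z w = 0 → ∀ s : ℝ, 0 < s →
        ContinuousAt (fn d) (w + s • β) ∧
        ∃ a, Tendsto (fn c) (𝓝[{h | z h < 0}] w) (𝓝 a) ∧
          Tendsto (fn c) (𝓝[{h | 0 < z h}] w) (𝓝 (a + fn d (w + s • β))) := by
  induction c using Comb.induction with
  | zero =>
    refine ⟨0, by simp, by simp, fun w _ _ s _ => ⟨?_, 0, ?_, ?_⟩⟩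
    · rw [map_zero]; exact continuousAt_const
    · rw [map_zero]; exact tendsto_const_nhds
    · rw [map_zero, Pi.zero_apply, add_zero]; exact tendsto_const_nhds
  | add c₁ c₂ h₁ h₂ =>
    obtain ⟨d₁, hl₁, hn₁, hw₁⟩ := h₁
    obtain ⟨d₂, hl₂, hn₂, hw₂⟩ := h₂
    refine ⟨d₁ + d₂, fun y hy => ?_, fun h hh => ?_, fun w hw hzw s hs => ?_⟩
    · simp only [map_add, Pi.add_apply, hl₁ y hy, hl₂ y hy]
      ring
    · simp [hn₁ h hh, hn₂ h hh]
    · obtain ⟨hc₁, a₁, ha₁, hb₁⟩ := hw₁ w hw hzw s hs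
      obtain ⟨hc₂, a₂, ha₂, hb₂⟩ := hw₂ w hw hzw s hs
      rw [map_add, map_add]
      refine ⟨hc₁.add hc₂, a₁ + a₂, ha₁.add ha₂, ?_⟩
      rw [Pi.add_apply, add_add_add_comm]
      exact hb₁.add hb₂
  | smul x c₁ h₁ =>
    obtain ⟨d₁, hl₁, hn₁, hw₁⟩ := h₁
    refine ⟨x • d₁, fun y hy => ?_, fun h hh => ?_, fun w hw hzw s hs => ?_⟩
    · simp only [map_smul, Pi.smul_apply, hl₁ y hy, smul_eq_mul]
      ring
    · simp [hn₁ h hh]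
    · obtain ⟨hc₁, a₁, ha₁, hb₁⟩ := hw₁ w hw hzw s hs
      rw [map_smul, map_smul]
      refine ⟨hc₁.const_smul x, x • a₁, ha₁.const_smul x, ?_⟩
      rw [Pi.smul_apply, ← smul_add]
      exact hb₁.const_smul x
  | single b m =>
    -- A point of the hyperplane `z = 0` outside all other walls can have a zero coordinate only if
    -- the corresponding facet hyperplane of the cone is `z = 0` itself.
    have htrans : ∀ w ∈ regAlong Δ (LinearMap.ker (z : V →ₗ[ℝ] ℝ)), z w = 0 → ∀ l,
        b.basis.repr w l = 0 → IsTransverse z b.basis l := by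
      intro w hw hzw l hl
      refine isTransverse_of_ker_coord_eq ?_
      by_contra hne
      exact hw _ (isWall_ker_coord b.basis b.mem l) hne hl
    by_cases hex : ∃ i, IsTransverse z b.basis i ∧ m i = 0
    · obtain ⟨i, hi, hmi⟩ := hex
      have hzi := hi.1
      have hβi : b.basis.repr β i ≠ 0 := fun h0 => hzβ (by rw [hi.apply_eq β, h0, zero_mul])
      -- Trading `b i` for `β` keeps the facet of the cone lying in `z = 0` and turns the transverse
      -- edge into `β`. Since `m i = 0`, the new monomial is constant along `β` inside the cone.
      obtain ⟨b', hb'⟩ := exists_basis_update b.basis hβi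
      have hb'i : b' i = β := by rw [hb', Function.update_self]
      have hb'l : ∀ l, l ≠ i → b' l = b.basis l := fun l hl => by
        rw [hb', Function.update_of_ne hl]
      have hi' : IsTransverse z b' i :=
        ⟨by rwa [hb'i], fun l hl => by rw [hb'l l hl, hi.2 l hl]⟩
      let B : PosBasis Δ δ r := ⟨b', fun l => by
        by_cases hl : l = i
        · rw [hl, hb'i]; exact hβ
        · rw [hb'l l hl]; exact b.mem l, fun l => by
        by_cases hl : l = i
        · rw [hl, hb'i]; exact hpos
        · rw [hb'l l hl]; exact b.pos l⟩
      -- The cone of `b` lies on the side of the wall given by the sign of `z (b i)`, which is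
      -- therefore the sign of the jump. It converts `|z (b i)|⁻¹`, coming from the volume of `b'`,
      -- into the factor `(z (b i))⁻¹` of `genBoundary`.
      have hsign : Real.sign (z (b.basis i)) * |z (b.basis i)|⁻¹ = (z (b.basis i))⁻¹ := by
        rcases lt_or_gt_of_ne hzi with h | h
        · rw [Real.sign_of_neg h, abs_of_neg h]
          field_simp
        · rw [Real.sign_of_pos h, abs_of_pos h, one_mul]
      refine ⟨Finsupp.single (B, m) (Real.sign (z (b.basis i))), fun y hy => ?_, fun h hh => ?_,
        fun w hw hzw s hs => ?_⟩
      · have hyβ := hy β hβ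
        rw [lap_single, boundary_single, one_smul, Pi.smul_apply, smul_eq_mul, genLap,
          genBoundary_of_isTransverse ω hi hmi, ← Finset.mul_prod_erase _ _ (Finset.mem_univ i),
          Finset.prod_congr rfl fun l hl => by
            rw [show B.basis l = b.basis l from hb'l l (Finset.ne_of_mem_erase hl)],
          show B.basis i = β from hb'i, hmi, show ⇑B.basis = Function.update b.basis i β from hb',
          map_update_basis, abs_mul]
        have hrepr : |b.basis.repr β i| = |z β| * |z (b.basis i)|⁻¹ := by
          rw [hi.apply_eq β, abs_mul, mul_inv_cancel_right₀ (abs_ne_zero.2 hzi)]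
        rw [hrepr, ← hsign]
        simp only [Nat.factorial_zero, Nat.cast_one, zero_add, pow_one, div_eq_mul_inv]
        ring
      · rw [fn_single, Pi.smul_apply]
        have : b'.repr h i ≤ 0 := by
          have : b'.repr h i = z h / z β := by
            rw [hi'.apply_eq h, hb'i, mul_div_cancel_right₀ _ hzβ]
          rwa [this]
        have h0 : genFun B.basis m h = 0 :=
          Finset.prod_eq_zero (Finset.mem_univ i) (truncPow_of_nonpos this)
        rw [h0, smul_zero]
      · have hwi : b.basis.repr w i = 0 := by
          have := hi.apply_eq w
          rw [hzw] at this
          exact (mul_eq_zero.1 this.symm).resolve_right hzi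
        have hwl : ∀ l, l ≠ i → b.basis.repr w l ≠ 0 := fun l hl h0 =>
          hl (hi.eq (htrans w hw hzw l h0).1)
        have hrepr : ∀ l, b'.repr (w + s • β) l =
            Function.update (fun l => b.basis.repr w l) i s l := by
          intro l
          have hsum : w + s • β =
              ∑ l, Function.update (fun l => b.basis.repr w l) i s l • b' l := by
            rw [← Finset.add_sum_erase _ _ (Finset.mem_univ i), Function.update_self, hb'i,
              add_comm]
            congr 1
            conv_lhs => rw [← b.basis.sum_repr w,
              ← Finset.add_sum_erase _ _ (Finset.mem_univ i), hwi, zero_smul, zero_add]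
            refine Finset.sum_congr rfl fun l hl => ?_
            have hl := Finset.ne_of_mem_erase hl
            rw [Function.update_of_ne hl, hb'l l hl]
          rw [hsum, b'.repr_sum_self]
        have hne : ∀ l, b'.repr (w + s • β) l ≠ 0 := by
          intro l
          rw [hrepr]
          by_cases hl : l = i
          · rw [hl, Function.update_self]; exact hs.ne'
          · rw [Function.update_of_ne hl]; exact hwl l hl
        set P : V → ℝ := fun h => ∏ l ∈ Finset.univ.erase i, truncPow (m l) (b.basis.repr h l)
        have hP : ContinuousAt P w := by
          refine tendsto_finsetProd _ fun l hl => ?_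
          exact ContinuousAt.comp (f := fun h => b.basis.repr h l)
            (continuousAt_truncPow _ (hwl l (Finset.ne_of_mem_erase hl)))
            (continuous_repr b.basis l).continuousAt
        have hgen : ∀ h, genFun b.basis m h = truncPow 0 (b.basis.repr h i) * P h := by
          intro h
          rw [genFun, ← Finset.mul_prod_erase _ _ (Finset.mem_univ i), hmi]
        have hjump : genFun b' m (w + s • β) = P w := by
          rw [genFun, ← Finset.mul_prod_erase _ _ (Finset.mem_univ i), hrepr i,
            Function.update_self, hmi, truncPow_of_pos hs, pow_zero, one_mul]
          refine Finset.prod_congr rfl fun l hl => ?_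
          rw [hrepr, Function.update_of_ne (Finset.ne_of_mem_erase hl)]
        rw [fn_single, fn_single, one_smul]
        refine ⟨(continuousAt_genFun b' m (fun l => Or.inl (hne l)) Finset.univ).const_smul _, ?_⟩
        have hone : ∀ S : Set V, (∀ h ∈ S, 0 < b.basis.repr h i) →
            Tendsto (genFun b.basis m) (𝓝[S] w) (𝓝 (P w)) := by
          intro S hS
          refine (hP.tendsto.mono_left nhdsWithin_le_nhds).congr' ?_
          filter_upwards [self_mem_nhdsWithin] with h hh
          rw [hgen, truncPow_of_pos (hS h hh), pow_zero, one_mul]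
        have hzero : ∀ S : Set V, (∀ h ∈ S, b.basis.repr h i ≤ 0) →
            Tendsto (genFun b.basis m) (𝓝[S] w) (𝓝 0) := by
          intro S hS
          refine tendsto_const_nhds.congr' ?_
          filter_upwards [self_mem_nhdsWithin] with h hh
          rw [hgen, truncPow_of_nonpos (hS h hh), zero_mul]
        rw [Pi.smul_apply, show genFun B.basis m (w + s • β) = P w from hjump]
        rcases lt_or_gt_of_ne hzi with hlt | hgt
        · refine ⟨P w, hone _ fun h hh => ?_, ?_⟩
          · rw [mem_ofPred_eq, hi.apply_eq h] at hh
            exact pos_of_mul_neg_left hh hlt.le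
          · rw [Real.sign_of_neg hlt, neg_smul, one_smul, add_neg_cancel]
            refine hzero _ fun h hh => ?_
            rw [mem_ofPred_eq, hi.apply_eq h] at hh
            exact (neg_of_mul_pos_left hh hlt.le).le
        · refine ⟨0, hzero _ fun h hh => ?_, ?_⟩
          · rw [mem_ofPred_eq, hi.apply_eq h] at hh
            exact (neg_of_mul_neg_left hh hgt.le).le
          · rw [Real.sign_of_pos hgt, one_smul, zero_add]
            refine hone _ fun h hh => ?_
            rw [mem_ofPred_eq, hi.apply_eq h] at hh
            exact pos_of_mul_pos_left hh hgt.le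
    · push Not at hex
      refine ⟨0, fun y _ => ?_, by simp, fun w hw hzw s _ => ?_⟩
      · rw [boundary_single, one_smul, genBoundary_of_forall_not ω hex]
        simp
      · have hc : ContinuousAt (genFun b.basis m) w :=
          continuousAt_genFun b.basis m (fun l => by
            by_cases hl : b.basis.repr w l = 0
            · exact Or.inr (Nat.pos_of_ne_zero (hex l (htrans w hw hzw l hl)))
            · exact Or.inl hl) Finset.univ
        rw [map_zero, fn_single, one_smul]
        refine ⟨continuousAt_const, genFun b.basis m w, hc.tendsto.mono_left nhdsWithin_le_nhds, ?_⟩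
        rw [Pi.zero_apply, add_zero]
        exact hc.tendsto.mono_left nhdsWithin_le_nhds

end

section

open scoped Nat

variable {V : Type*} [NormedAddCommGroup V] [NormedSpace ℝ V]
  {Δ : Finset V} {δ : Set (StrongDual ℝ V)} {r : ℕ}

/-! ### Directional derivatives of formal combinations -/

/-- The directional derivative of a monomial on a cone. -/
def genDeriv (v : V) (p : PosBasis Δ δ r × (Fin r → ℕ)) : Comb Δ δ r :=
  -- A zero exponent contributes nothing, in spite of the truncated subtraction: the derivative
  -- ignores the jump, and only sees regular points.
  ∑ i, (p.1.basis.repr v i * p.2 i) •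
    Finsupp.single (p.1, Function.update p.2 i (p.2 i - 1)) (1 : ℝ)

/-- The directional derivative of a formal combination. -/
def dirDeriv : V →ₗ[ℝ] Comb Δ δ r →ₗ[ℝ] Comb Δ δ r where
  toFun v := Finsupp.linearCombination ℝ (genDeriv v)
  map_add' u v := by
    refine Finsupp.lhom_ext fun p a => ?_
    simp only [LinearMap.add_apply, Finsupp.linearCombination_single, ← smul_add, genDeriv,
      ← Finset.sum_add_distrib, map_add, Finsupp.add_apply, add_mul, add_smul]
  map_smul' x v := by
    refine Finsupp.lhom_ext fun p a => ?_
    simp only [LinearMap.smul_apply, Finsupp.linearCombination_single, genDeriv, map_smul,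
      Finsupp.smul_apply, smul_eq_mul, mul_assoc, mul_smul, ← Finset.smul_sum, RingHom.id_apply]
    exact smul_comm a x _

lemma dirDeriv_single (v : V) (b : PosBasis Δ δ r) (m : Fin r → ℕ) :
    dirDeriv v (Finsupp.single (b, m) (1 : ℝ)) = genDeriv v (b, m) := by
  change Finsupp.linearCombination ℝ (genDeriv v) _ = _
  rw [Finsupp.linearCombination_single, one_smul]

lemma hasFDerivAt_fn [FiniteDimensional ℝ V] (c : Comb Δ δ r) {x : V} (hx : x ∈ reg Δ) :
    ∃ D : V →L[ℝ] ℝ, HasFDerivAt (fn c) D x ∧ ∀ u, D u = fn (dirDeriv u c) x := by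
  induction c using Comb.induction with
  | zero => exact ⟨0, by rw [map_zero]; exact hasFDerivAt_const _ _, by simp⟩
  | add c d hc hd =>
    obtain ⟨D, hD, h⟩ := hc
    obtain ⟨D', hD', h'⟩ := hd
    exact ⟨D + D', by rw [map_add]; exact hD.add hD', by simp [h, h']⟩
  | smul a c hc =>
    obtain ⟨D, hD, h⟩ := hc
    exact ⟨a • D, by rw [map_smul]; exact hD.const_smul a, by simp [h]⟩
  | single b m =>
    have hne := repr_ne_zero_of_mem_reg b.basis b.mem hx
    have hfac : ∀ i ∈ Finset.univ, HasFDerivAt (fun h => truncPow (m i) (b.basis.repr h i))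
        ((m i * truncPow (m i - 1) (b.basis.repr x i)) •
          LinearMap.toContinuousLinearMap (b.basis.coord i)) x := fun i _ =>
      HasDerivAt.comp_hasFDerivAt (f := fun h => b.basis.repr h i) x
        (hasDerivAt_truncPow (m i) (hne i))
        (LinearMap.toContinuousLinearMap (b.basis.coord i)).hasFDerivAt
    rw [fn_single, one_smul]
    refine ⟨_, HasFDerivAt.finsetProd hfac, fun u => ?_⟩
    · rw [dirDeriv_single, genDeriv, map_sum, Finset.sum_apply]
      simp only [map_smul, fn_single, one_smul, Pi.smul_apply, sum_apply,
        smul_apply, smul_eq_mul, LinearMap.coe_toContinuousLinearMap', Basis.coord_apply]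
      refine Finset.sum_congr rfl fun i _ => ?_
      have hprod : ∏ l ∈ Finset.univ.erase i,
          truncPow (Function.update m i (m i - 1) l) (b.basis.repr x l) =
          ∏ l ∈ Finset.univ.erase i, truncPow (m l) (b.basis.repr x l) :=
        Finset.prod_congr rfl fun l hl => by
          rw [Function.update_of_ne (Finset.ne_of_mem_erase hl)]
      rw [genFun, ← Finset.mul_prod_erase _ _ (Finset.mem_univ i), Function.update_self, hprod]
      ring

lemma continuousAt_fn [FiniteDimensional ℝ V] (c : Comb Δ δ r) {x : V} (hx : x ∈ reg Δ) :
    ContinuousAt (fn c) x :=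
  let ⟨_, hD, _⟩ := hasFDerivAt_fn c hx
  hD.continuousAt

lemma exists_bound_fn [FiniteDimensional ℝ V] (c : Comb Δ δ r) (R : ℝ) :
    ∃ C, ∀ x ∈ Metric.closedBall (0 : V) R, |fn c x| ≤ C := by
  induction c using Comb.induction with
  | zero => exact ⟨0, by simp⟩
  | add c d hc hd =>
    obtain ⟨C, hC⟩ := hc
    obtain ⟨D, hD⟩ := hd
    refine ⟨C + D, fun x hx => ?_⟩
    rw [map_add]
    exact (abs_add_le _ _).trans (add_le_add (hC x hx) (hD x hx))
  | smul a c hc =>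
    obtain ⟨C, hC⟩ := hc
    refine ⟨|a| * C, fun x hx => ?_⟩
    rw [map_smul, Pi.smul_apply, smul_eq_mul, abs_mul]
    exact mul_le_mul_of_nonneg_left (hC x hx) (abs_nonneg a)
  | single b m =>
    have hcont : Continuous fun x => ∏ i, |b.basis.repr x i| ^ m i :=
      continuous_finsetProd _ fun i _ => ((continuous_repr b.basis i).abs).pow _
    obtain ⟨C, hC⟩ := (isCompact_closedBall (0 : V) R).exists_bound_of_continuousOn
      hcont.continuousOn
    refine ⟨C, fun x hx => le_trans ?_ ((le_abs_self _).trans (hC x hx))⟩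
    rw [fn_single, one_smul, genFun, Finset.abs_prod]
    exact Finset.prod_le_prod (fun _ _ => abs_nonneg _) fun i _ => abs_truncPow_le _ _

lemma fn_dirDeriv_eq_sum (b : Basis (Fin r) ℝ V) (c : Comb Δ δ r) (u x : V) :
    fn (dirDeriv u c) x = ∑ i, b.repr u i * fn (dirDeriv (b i) c) x := by
  conv_lhs => rw [← b.sum_repr u]
  simp only [map_sum, map_smul, LinearMap.sum_apply, LinearMap.smul_apply, Finset.sum_apply,
    Pi.smul_apply, smul_eq_mul]

lemma exists_bound_fn_dirDeriv [FiniteDimensional ℝ V] (hr : finrank ℝ V = r)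
    (c : Comb Δ δ r) (R : ℝ) :
    ∃ C : ℝ, 0 ≤ C ∧ ∀ x ∈ Metric.closedBall (0 : V) R, ∀ u, |fn (dirDeriv u c) x| ≤ C * ‖u‖ := by
  let b := finBasisOfFinrankEq ℝ V hr
  choose C hC using fun i => exists_bound_fn (dirDeriv (b i) c) R
  refine ⟨∑ i, ‖LinearMap.toContinuousLinearMap (b.coord i)‖ * |C i|,
    Finset.sum_nonneg fun i _ => by positivity, fun x hx u => ?_⟩
  rw [fn_dirDeriv_eq_sum b, Finset.sum_mul]
  refine (Finset.abs_sum_le_sum_abs _ _).trans (Finset.sum_le_sum fun i _ => ?_)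
  rw [abs_mul, mul_right_comm]
  exact mul_le_mul ((LinearMap.toContinuousLinearMap (b.coord i)).le_opNorm u)
    ((hC i x hx).trans (le_abs_self _)) (abs_nonneg _) (by positivity)

/-- For `m i > 0` this is `y * m! / y ^ (m + 1) = m * (m - 1)! / y ^ m`. For `m i = 0` the
derivative term is absent and the boundary term of the integration by parts, carried by the facet
opposite to `b i`, remains. -/
lemma lap_genDeriv_term (ω : V [⋀^Fin r]→ₗ[ℝ] ℝ) (b : Basis (Fin r) ℝ V) (m : Fin r → ℕ)
    {y : StrongDual ℝ V} (i : Fin r) (hy : y (b i) ≠ 0) :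
    y (b i) * genLap ω b m y - m i * genLap ω b (Function.update m i (m i - 1)) y =
      if m i = 0 then |ω b| * ∏ l ∈ Finset.univ.erase i, ((m l)! / y (b l) ^ (m l + 1) : ℝ)
      else 0 := by
  have hprod : ∏ l ∈ Finset.univ.erase i, ((Function.update m i (m i - 1) l)! /
      y (b l) ^ (Function.update m i (m i - 1) l + 1) : ℝ) =
      ∏ l ∈ Finset.univ.erase i, ((m l)! / y (b l) ^ (m l + 1) : ℝ) :=
    Finset.prod_congr rfl fun l hl => by
      rw [Function.update_of_ne (Finset.ne_of_mem_erase hl)]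
  simp only [genLap]
  rw [← Finset.mul_prod_erase _ _ (Finset.mem_univ i),
    ← Finset.mul_prod_erase (a := i) _ (fun l => ((Function.update m i (m i - 1) l)! /
      y (b l) ^ (Function.update m i (m i - 1) l + 1) : ℝ)) (Finset.mem_univ i),
    Function.update_self, hprod]
  split_ifs with h
  · rw [h]
    simp only [Nat.cast_zero, zero_mul, sub_zero, Nat.factorial_zero, Nat.cast_one, zero_add,
      pow_one]
    field_simp
  · obtain ⟨p, hp⟩ := Nat.exists_eq_succ_of_ne_zero h
    rw [hp, Nat.succ_sub_one, Nat.factorial_succ, Nat.succ_eq_add_one]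
    push_cast
    field_simp
    ring

/-- The defect of the rule "the Laplace transform of a derivative is a product", as a sum over
the walls. -/
lemma lap_dirDeriv_defect [FiniteDimensional ℝ V] (ω : V [⋀^Fin r]→ₗ[ℝ] ℝ)
    {Z : Submodule ℝ V → StrongDual ℝ V}
    (hZ : ∀ W, IsWall Δ W → W = LinearMap.ker (Z W : V →ₗ[ℝ] ℝ)) (v : V) (c : Comb Δ δ r)
    {y : StrongDual ℝ V} (hy : y ∈ dualReg Δ) :
    y v * lap ω c y - lap ω (dirDeriv v c) y = ∑ W ∈ walls Δ, Z W v * boundary ω (Z W) c y := by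
  classical
  induction c using Comb.induction with
  | zero => simp
  | add c d hc hd =>
    simp only [map_add, Pi.add_apply, mul_add, Finset.sum_add_distrib, ← hc, ← hd]
    ring
  | smul a c hc =>
    simp only [map_smul, Pi.smul_apply, smul_eq_mul, mul_left_comm _ a, ← Finset.mul_sum, ← hc]
    ring
  | single b m =>
    have htr : ∀ W ∈ walls Δ, ∀ i,
        IsTransverse (Z W) b.basis i ↔ W = LinearMap.ker (b.basis.coord i) := by
      intro W hW i
      have hW := hZ W (mem_walls.1 hW)
      refine ⟨fun h => by rw [← h.ker_eq]; exact hW, fun h => isTransverse_of_ker_coord_eq ?_⟩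
      rw [← h]; exact hW
    set R : Fin r → ℝ := fun i =>
      ∏ l ∈ Finset.univ.erase i, ((m l)! / y (b.basis l) ^ (m l + 1) : ℝ) with hR
    have hright : ∀ W ∈ walls Δ, Z W v * boundary ω (Z W) (Finsupp.single (b, m) 1) y =
        ∑ i, if W = LinearMap.ker (b.basis.coord i) then
          (if m i = 0 then b.basis.repr v i * (|ω b.basis| * R i) else 0) else 0 := by
      intro W hW
      rw [boundary_single, one_smul, genBoundary, Finset.mul_sum, Finset.mul_sum]
      refine Finset.sum_congr rfl fun i _ => ?_
      by_cases h : W = LinearMap.ker (b.basis.coord i)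
      · have ht := (htr W hW i).2 h
        rw [if_pos h]
        by_cases hm : m i = 0
        · rw [if_pos ⟨ht, hm⟩, if_pos hm, ht.apply_eq v]
          have := ht.1
          field_simp
          rw [hR]
        · rw [if_neg fun h => hm h.2, if_neg hm, mul_zero, mul_zero]
      · rw [if_neg fun h' => h ((htr W hW i).1 h'.1), if_neg h, mul_zero, mul_zero]
    -- Each `i` is transverse to exactly one wall, the kernel of its coordinate, so after exchanging
    -- the sums the sum over walls has a single term.
    rw [Finset.sum_congr rfl hright, Finset.sum_comm]
    have hyv : y v = ∑ i, b.basis.repr v i * y (b.basis i) := by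
      conv_lhs => rw [← b.basis.sum_repr v, map_sum]
      simp
    rw [dirDeriv_single, genDeriv, map_sum, Finset.sum_apply, hyv, Finset.sum_mul,
      ← Finset.sum_sub_distrib]
    refine Finset.sum_congr rfl fun i _ => ?_
    rw [Finset.sum_ite_eq_of_mem' _ _ _ (mem_walls.2 (isWall_ker_coord b.basis b.mem i))]
    have := lap_genDeriv_term ω b.basis m i (hy _ (b.mem i))
    simp only [map_smul, lap_single, one_smul, Pi.smul_apply, smul_eq_mul]
    rw [one_mul, mul_assoc, mul_assoc, ← mul_sub, this, mul_ite, mul_zero]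

/-- If all leading coefficients at infinity along the walls vanish, then the Laplace transform
takes derivatives to products. -/
lemma lap_dirDeriv [FiniteDimensional ℝ V] (ω : V [⋀^Fin r]→ₗ[ℝ] ℝ) (c : Comb Δ δ r)
    (h : ∀ z : StrongDual ℝ V, z ≠ 0 → ∀ y ∈ dualReg Δ, boundary ω z c y = 0) (v : V)
    {y : StrongDual ℝ V} (hy : y ∈ dualReg Δ) : lap ω (dirDeriv v c) y = y v * lap ω c y := by
  choose! Z hZ0 hZ using fun W (hW : IsWall Δ W) => hW.exists_eq_ker
  have := lap_dirDeriv_defect ω hZ v c hy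
  rw [Finset.sum_eq_zero fun W hW => by rw [h _ (hZ0 W (mem_walls.1 hW)) y hy, mul_zero]] at this
  linarith

end

section

variable {V : Type*} [NormedAddCommGroup V] [NormedSpace ℝ V]
  {Δ : Finset V} {δ : Set (StrongDual ℝ V)} {r : ℕ}

/-! ### Extensions of class `C^k` -/

/-- The restriction of `F` to the regular elements extends to a function of class `C^k`
on `U`. -/
def ExtOn (Δ : Finset V) (F : V → ℝ) (k : ℕ) (U : Set V) : Prop :=
  ∃ g : V → ℝ, (∀ h ∈ reg Δ, g h = F h) ∧ ContDiffOn ℝ k g U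

lemma ExtOn.mono {F : V → ℝ} {k l : ℕ} {U U' : Set V} (h : ExtOn Δ F k U) (hl : l ≤ k)
    (hU : U' ⊆ U) : ExtOn Δ F l U' :=
  let ⟨g, hg, hc⟩ := h
  ⟨g, hg, (hc.mono hU).of_le (by exact_mod_cast hl)⟩

/-- A line meeting a subspace `W` at two points has its direction in `W`, and then also its origin.
So each of the finitely many walls is met at most once. -/
lemma countable_line_notMem_reg [FiniteDimensional ℝ V] {x u : V}
    (h : ∀ W, IsWall Δ W → x ∉ W ∨ u ∉ W) : {s : ℝ | x + s • u ∉ reg Δ}.Countable := by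
  have : {s : ℝ | x + s • u ∉ reg Δ} ⊆
      ⋃ W ∈ {W : Submodule ℝ V | IsWall Δ W}, {s : ℝ | x + s • u ∈ W} := by
    intro s hs
    simp only [reg, mem_ofPred_eq, not_forall, not_not] at hs
    obtain ⟨W, hW, hs⟩ := hs
    simp only [mem_iUnion]
    exact ⟨W, hW, hs⟩
  refine Countable.mono this ((finite_setOf_isWall Δ).countable.biUnion fun W hW => ?_)
  refine Subsingleton.countable fun s hs t ht => ?_
  by_contra hst
  have h1 : (s - t) • u ∈ W := by
    have := W.sub_mem hs ht
    rwa [add_sub_add_left_eq_sub, ← sub_smul] at this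
  have hu : u ∈ W := (W.smul_mem_iff (sub_ne_zero.2 hst)).1 h1
  have hx : x ∈ W := (W.add_mem_iff_left (W.smul_mem s hu)).1 hs
  exact (h W hW).elim (fun h => h hx) fun h => h hu

/-- A mean value inequality along a segment which crosses the walls at countably many points. -/
lemma abs_sub_sub_le_of_segment [FiniteDimensional ℝ V] (c : Comb Δ δ r) {g : V → ℝ}
    (hg : ∀ h ∈ reg Δ, g h = fn c h) {x u : V} {a ε : ℝ}
    (hcont : ContinuousOn (fun s : ℝ => g (x + s • u)) (Icc 0 1))
    (hcount : {s : ℝ | x + s • u ∉ reg Δ}.Countable)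
    (hbd : ∀ s ∈ Icc (0 : ℝ) 1, x + s • u ∈ reg Δ → |fn (dirDeriv u c) (x + s • u) - a| ≤ ε) :
    |g (x + u) - g x - a| ≤ ε := by
  borelize V
  set F' : ℝ → ℝ := fun s => fn (dirDeriv u c) (x + s • u) - a
  have hmeas : Measurable F' :=
    ((measurable_fn _).comp (by fun_prop : Continuous fun s : ℝ => x + s • u).measurable).sub_const a
  have hae : ∀ᵐ s : ℝ, s ∈ Ioc (0 : ℝ) 1 → ‖F' s‖ ≤ ε := by
    filter_upwards [hcount.ae_notMem volume] with s hs hs1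
    exact hbd s (Ioc_subset_Icc_self hs1) (not_not.1 hs)
  have hint : IntervalIntegrable F' volume 0 1 := by
    rw [intervalIntegrable_iff_integrableOn_Ioc_of_le zero_le_one]
    exact Measure.integrableOn_of_bounded (by simp) hmeas.aestronglyMeasurable
      ((ae_restrict_iff' measurableSet_Ioc).2 hae)
  have hderiv : ∀ s ∈ Ioo (min (0 : ℝ) 1) (max 0 1) \ {s : ℝ | x + s • u ∉ reg Δ},
      HasDerivAt (fun s : ℝ => g (x + s • u) - s * a) (F' s) s := by
    intro s hs
    have hs : x + s • u ∈ reg Δ := not_not.1 hs.2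
    obtain ⟨D, hD, hDu⟩ := hasFDerivAt_fn c hs
    have hgD : HasFDerivAt g D (x + s • u) := by
      refine hD.congr_of_eventuallyEq ?_
      filter_upwards [(isOpen_reg Δ).mem_nhds hs] with h hh using hg h hh
    have hline : HasDerivAt (fun s : ℝ => x + s • u) u s := by
      simpa using ((hasDerivAt_id s).smul_const u).const_add x
    have h1 : HasDerivAt (fun s : ℝ => g (x + s • u)) (D u) s := hgD.comp_hasDerivAt s hline
    have h2 : HasDerivAt (fun s : ℝ => s * a) a s := by
      simpa using (hasDerivAt_id s).mul_const a
    rw [hDu] at h1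
    exact h1.sub h2
  -- The fundamental theorem of calculus allows a countable exceptional set because `g` is
  -- continuous along the segment.
  have hint_eq := MeasureTheory.integral_eq_of_hasDerivAt_off_countable
    (fun s : ℝ => g (x + s • u) - s * a) F' hcount (by
      rw [uIcc_of_le zero_le_one]
      exact hcont.sub (by fun_prop)) hderiv hint
  have hle : ‖∫ s in (0 : ℝ)..1, F' s‖ ≤ ε * |1 - 0| :=
    intervalIntegral.norm_integral_le_of_norm_le_const_ae (by
      rw [uIoc_of_le zero_le_one]; exact hae)
  rw [hint_eq] at hle
  simpa [sub_right_comm] using hle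

/-- Regular points are dense, so extension by limits is continuous wherever the limits exist on `U`.
-/
lemma extOn_zero_of_forall_tendsto [FiniteDimensional ℝ V] (c : Comb Δ δ r) {U : Set V}
    (h : ∀ x ∈ U, ∃ a, Tendsto (fn c) (𝓝[reg Δ] x) (𝓝 a)) :
    (∀ x ∈ reg Δ, extendFrom (reg Δ) (fn c) x = fn c x) ∧
      ContinuousOn (extendFrom (reg Δ) (fn c)) U := by
  refine ⟨extendFrom_extends fun x hx => (continuousAt_fn c hx).continuousWithinAt, ?_⟩
  exact continuousOn_extendFrom (fun x _ => dense_reg Δ x) h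

/-- A combination extends to a function of class `C^(k+1)` if and only if it extends to a
continuous function and its directional derivatives extend to functions of class `C^k`. -/
lemma extOn_succ_iff [FiniteDimensional ℝ V] (hr : finrank ℝ V = r) (c : Comb Δ δ r) (k : ℕ)
    {U : Set V} (hU : IsOpen U) :
    ExtOn Δ (fn c) (k + 1) U ↔
      ExtOn Δ (fn c) 0 U ∧ ∀ v, ExtOn Δ (fn (dirDeriv v c)) k U := by
  constructor
  · intro h
    refine ⟨h.mono (Nat.zero_le _) subset_rfl, fun v => ?_⟩
    obtain ⟨g, hg, hc⟩ := h
    refine ⟨fun x => fderiv ℝ g x v, fun x hx => ?_, ?_⟩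
    · obtain ⟨D, hD, hDu⟩ := hasFDerivAt_fn c hx
      have : HasFDerivAt g D x := by
        refine hD.congr_of_eventuallyEq ?_
        filter_upwards [(isOpen_reg Δ).mem_nhds hx] with h hh using hg h hh
      simp only [this.fderiv, hDu]
    · have := ((contDiffOn_succ_iff_fderiv_of_isOpen (n := (k : ℕ)) hU).1
        (by exact_mod_cast hc)).2.2
      exact this.clm_apply contDiffOn_const
  · rintro ⟨⟨g, hg, hc⟩, hd⟩
    have hgc : ContinuousOn g U := hc.continuousOn
    let b := finBasisOfFinrankEq ℝ V hr
    choose G hG hGc using fun i => hd (b i)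
    let D : V → V →L[ℝ] ℝ := fun x => ∑ i, G i x • LinearMap.toContinuousLinearMap (b.coord i)
    -- `D` is the only candidate for the derivative: it is assembled from the extended partial
    -- derivatives and is right at regular points.
    have hDreg : ∀ x ∈ reg Δ, ∀ u, D x u = fn (dirDeriv u c) x := by
      intro x hx u
      rw [fn_dirDeriv_eq_sum b]
      simp [D, hG _ x hx, mul_comm]
    have hDc : ContDiffOn ℝ k D U := ContDiffOn.sum fun i _ => (hGc i).smul contDiffOn_const
    have hderiv : ∀ x ∈ U, HasFDerivAt g (D x) x := by
      intro x hx
      rw [hasFDerivAt_iff_isLittleO_nhds_zero, Asymptotics.isLittleO_iff]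
      intro ε hε
      have hnear : ∀ᶠ y in 𝓝 x, y ∈ U ∧ ‖D y - D x‖ ≤ ε := by
        refine (hU.eventually_mem hx).and ?_
        have := (hDc.continuousOn.continuousAt (hU.mem_nhds hx))
        filter_upwards [this.eventually (Metric.ball_mem_nhds _ hε)] with y hy
        rw [← dist_eq_norm]
        exact (Metric.mem_ball.1 hy).le
      obtain ⟨ρ, hρ, hball⟩ := Metric.eventually_nhds_iff_ball.1 hnear
      -- A segment in a regular direction crosses each wall at most once, wherever it starts; other
      -- directions follow below by density and continuity.
      have hgen : ∀ u ∈ reg Δ, u ∈ Metric.ball (0 : V) ρ →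
          |g (x + u) - g x - D x u| ≤ ε * ‖u‖ := by
        intro u hu hur
        have hseg : ∀ s ∈ Icc (0 : ℝ) 1, x + s • u ∈ Metric.ball x ρ := by
          intro s hs
          rw [mem_ball_zero_iff] at hur
          rw [mem_ball_iff_norm, add_sub_cancel_left, norm_smul, Real.norm_of_nonneg hs.1]
          exact (mul_le_of_le_one_left (norm_nonneg u) hs.2).trans_lt hur
        refine abs_sub_sub_le_of_segment c hg ?_
          (countable_line_notMem_reg fun W hW => Or.inr (hu W hW)) fun s hs hsr => ?_
        · exact hgc.comp (by fun_prop) fun s hs => (hball _ (hseg s hs)).1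
        · rw [← hDreg _ hsr, ← sub_apply]
          exact (ContinuousLinearMap.le_opNorm _ u).trans
            (mul_le_mul_of_nonneg_right (hball _ (hseg s hs)).2 (norm_nonneg u))
      filter_upwards [Metric.ball_mem_nhds (0 : V) hρ] with u hu
      have hxu : x + u ∈ U := (hball (x + u) (by simpa using hu)).1
      have hNB : (𝓝[reg Δ] u).NeBot := mem_closure_iff_nhdsWithin_neBot.1 (dense_reg Δ u)
      have hadd : ContinuousAt (fun v => g (x + v)) u :=
        ContinuousAt.comp (f := fun v => x + v) (hgc.continuousAt (hU.mem_nhds hxu)) (by fun_prop)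
      have hl : ContinuousAt (fun v => |g (x + v) - g x - D x v|) u :=
        ((hadd.sub continuousAt_const).sub (D x).continuous.continuousAt).abs
      have hr : ContinuousAt (fun v => ε * ‖v‖) u := by fun_prop
      refine le_of_tendsto_of_tendsto (b := 𝓝[reg Δ] u) (hl.tendsto.mono_left nhdsWithin_le_nhds)
        (hr.tendsto.mono_left nhdsWithin_le_nhds) ?_
      filter_upwards [self_mem_nhdsWithin,
        nhdsWithin_le_nhds (Metric.isOpen_ball.mem_nhds hu)] with v hv hv' using hgen v hv hv'
    refine ⟨g, hg, ?_⟩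
    have : ContDiffOn ℝ ((k : ℕ) + 1) g U := by
      rw [contDiffOn_succ_iff_fderiv_of_isOpen hU]
      exact ⟨fun x hx => (hderiv x hx).differentiableAt.differentiableWithinAt, by simp,
        hDc.congr fun x hx => (hderiv x hx).fderiv⟩
    exact_mod_cast this

/-! ### Continuous extensions -/

/-- The points contained in at most one wall. -/
def atMostOneWall (Δ : Finset V) : Set V :=
  {x | ∀ W W', IsWall Δ W → IsWall Δ W' → x ∈ W → x ∈ W' → W = W'}

/-- Two distinct walls meet in codimension at least two, so adding a line leaves a proper subspace.
A segment from a regular `x` that meets `W ⊓ W'` must end in this subspace. -/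
lemma span_sup_inf_ne_top [FiniteDimensional ℝ V] {W W' : Submodule ℝ V} (hW : IsWall Δ W)
    (hW' : IsWall Δ W') (hne : W ≠ W') (x : V) : (ℝ ∙ x) ⊔ (W ⊓ W') ≠ ⊤ := by
  intro h
  have h1 := hW.finrank_add_one
  have h2 := hW'.finrank_add_one
  have hlt : finrank ℝ (W ⊓ W' : Submodule ℝ V) < finrank ℝ W := by
    refine Submodule.finrank_lt_finrank_of_lt (lt_of_le_of_ne inf_le_left fun he => hne ?_)
    exact Submodule.eq_of_le_of_finrank_eq (inf_eq_left.1 he) (by omega)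
  have h3 := Submodule.finrank_add_le_finrank_add_finrank (ℝ ∙ x) (W ⊓ W')
  rw [h, finrank_top] at h3
  have h4 : finrank ℝ (ℝ ∙ x) ≤ 1 := by
    simpa using finrank_span_le_card (R := ℝ) ({x} : Set V)
  omega

lemma dense_setOf_notMem_span_sup_inf [FiniteDimensional ℝ V] (Δ : Finset V) (x : V) :
    Dense {x' | ∀ W W', IsWall Δ W → IsWall Δ W' → W ≠ W' → x' ∉ (ℝ ∙ x) ⊔ (W ⊓ W')} := by
  set S : Set (Submodule ℝ V × Submodule ℝ V) :=
    {p | IsWall Δ p.1 ∧ IsWall Δ p.2 ∧ p.1 ≠ p.2}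
  have hS : S.Finite := ((finite_setOf_isWall Δ).prod (finite_setOf_isWall Δ)).subset
    fun p hp => ⟨hp.1, hp.2.1⟩
  have : {x' | ∀ W W', IsWall Δ W → IsWall Δ W' → W ≠ W' → x' ∉ (ℝ ∙ x) ⊔ (W ⊓ W')} =
      ⋂ p ∈ S, (((ℝ ∙ x) ⊔ (p.1 ⊓ p.2) : Submodule ℝ V) : Set V)ᶜ := by
    ext x'
    simp only [mem_ofPred_eq, mem_iInter, mem_compl_iff, SetLike.mem_coe, S]
    exact ⟨fun h p hp => h p.1 p.2 hp.1 hp.2.1 hp.2.2, fun h W W' hW hW' hne =>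
      h (W, W') ⟨hW, hW', hne⟩⟩
  rw [this]
  exact dense_biInter_of_isOpen (fun p _ => isOpen_compl_submodule _) hS.countable
    fun p hp => dense_compl_submodule (span_sup_inf_ne_top hp.1 hp.2.1 hp.2.2 x)

/-- A combination which extends continuously to the points contained in at most one wall extends
continuously to the whole space. -/
lemma extOn_univ_of_atMostOneWall [FiniteDimensional ℝ V] (hr : finrank ℝ V = r)
    (c : Comb Δ δ r)
    (h : ∀ x ∈ atMostOneWall Δ, ∃ a, Tendsto (fn c) (𝓝[reg Δ] x) (𝓝 a)) :
    ExtOn Δ (fn c) 0 univ := by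
  obtain ⟨hg, hgc⟩ := extOn_zero_of_forall_tendsto c h
  -- Local Lipschitz bounds on the regular set: the mean value inequality along segments with a
  -- generic endpoint, then density of such endpoints.
  have hlip : ∀ R : ℝ, ∃ C : ℝ, 0 ≤ C ∧ ∀ x ∈ reg Δ ∩ Metric.ball 0 R,
      ∀ x' ∈ reg Δ ∩ Metric.ball 0 R, |fn c x' - fn c x| ≤ C * ‖x' - x‖ := by
    intro R
    obtain ⟨C, hC0, hC⟩ := exists_bound_fn_dirDeriv hr c R
    refine ⟨C, hC0, fun x hx x' hx' => ?_⟩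
    have hgen : ∀ x' ∈ Metric.ball (0 : V) R, x' ∈ reg Δ →
        (∀ W W', IsWall Δ W → IsWall Δ W' → W ≠ W' → x' ∉ (ℝ ∙ x) ⊔ (W ⊓ W')) →
        |fn c x' - fn c x| ≤ C * ‖x' - x‖ := by
      intro x' hx'R hx' hx'S
      have hseg : ∀ s ∈ Icc (0 : ℝ) 1, x + s • (x' - x) ∈ Metric.ball (0 : V) R := fun s hs =>
        (convex_ball (0 : V) R).add_smul_sub_mem hx.2 hx'R hs
      have hone : ∀ s : ℝ, x + s • (x' - x) ∈ atMostOneWall Δ := by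
        intro s W W' hW hW' hxW hxW'
        by_contra hne
        have hs : s ≠ 0 := by
          rintro rfl
          rw [zero_smul, add_zero] at hxW
          exact hx.1 W hW hxW
        refine hx'S W W' hW hW' hne ?_
        have : x' = (1 - s⁻¹) • x + s⁻¹ • (x + s • (x' - x)) := by
          rw [smul_add, inv_smul_smul₀ hs, sub_smul, one_smul]
          abel
        rw [this]
        exact Submodule.add_mem_sup (Submodule.smul_mem _ _ (Submodule.mem_span_singleton_self x))
          (Submodule.smul_mem _ _ ⟨hxW, hxW'⟩)
      have := abs_sub_sub_le_of_segment c hg (x := x) (u := x' - x) (a := 0)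
        (ε := C * ‖x' - x‖) (hgc.comp (by fun_prop) fun s _ => hone s)
        (countable_line_notMem_reg fun W hW => Or.inl (hx.1 W hW)) fun s hs _ => by
          rw [sub_zero]
          exact hC _ (Metric.ball_subset_closedBall (hseg s hs)) _
      rwa [add_sub_cancel, hg x' hx', hg x hx.1, sub_zero] at this
    set S := {x' | ∀ W W', IsWall Δ W → IsWall Δ W' → W ≠ W' → x' ∉ (ℝ ∙ x) ⊔ (W ⊓ W')}
    have hNB : (𝓝[S] x').NeBot :=
      mem_closure_iff_nhdsWithin_neBot.1 (dense_setOf_notMem_span_sup_inf Δ x x')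
    have hl : ContinuousAt (fun v => |fn c v - fn c x|) x' :=
      ((continuousAt_fn c hx'.1).sub continuousAt_const).abs
    have hr : ContinuousAt (fun v => C * ‖v - x‖) x' := by fun_prop
    refine le_of_tendsto_of_tendsto (b := 𝓝[S] x') (hl.tendsto.mono_left nhdsWithin_le_nhds)
      (hr.tendsto.mono_left nhdsWithin_le_nhds) ?_
    filter_upwards [self_mem_nhdsWithin,
      nhdsWithin_le_nhds ((isOpen_reg Δ).mem_nhds hx'.1),
      nhdsWithin_le_nhds (Metric.isOpen_ball.mem_nhds hx'.2)] with v hv hv' hv''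
    exact hgen v hv'' hv' hv
  have hlim : ∀ x ∈ (univ : Set V), ∃ a, Tendsto (fn c) (𝓝[reg Δ] x) (𝓝 a) := by
    intro x _
    obtain ⟨C, hC0, hC⟩ := hlip (‖x‖ + 1)
    have hL : LipschitzOnWith ⟨C, hC0⟩ (fn c) (reg Δ ∩ Metric.ball 0 (‖x‖ + 1)) :=
      LipschitzOnWith.of_dist_le_mul fun u hu v hv => by
        rw [dist_eq_norm, dist_eq_norm]
        exact hC v hv u hu
    -- A Lipschitz extension to the whole space provides the limit at `x`.
    obtain ⟨G, hG, hGeq⟩ := hL.extend_real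
    refine ⟨G x, (hG.continuous.continuousAt.tendsto.mono_left nhdsWithin_le_nhds).congr' ?_⟩
    filter_upwards [self_mem_nhdsWithin, nhdsWithin_le_nhds
      (Metric.isOpen_ball.mem_nhds (show x ∈ Metric.ball (0 : V) (‖x‖ + 1) by simp))] with v hv hv'
    exact (hGeq ⟨hv, hv'⟩).symm
  obtain ⟨hg', hgc'⟩ := extOn_zero_of_forall_tendsto c hlim
  exact ⟨_, hg', by rw [Nat.cast_zero, contDiffOn_zero]; exact hgc'⟩

end

section

variable {V : Type*} [NormedAddCommGroup V] [NormedSpace ℝ V]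
  {Δ : Finset V} {δ : Set (StrongDual ℝ V)} {r : ℕ}

/-! ### Continuity and leading coefficients at infinity -/

/-- `Δ` spans, so some element lies off the hyperplane `z = 0`; up to sign it is positive on `δ`. It
serves as the direction `β` in `exists_jump`. -/
lemma exists_pos_of_ne_zero (hspan : Submodule.span ℝ (Δ : Set V) = ⊤)
    (hneg : ∀ α ∈ Δ, -α ∈ Δ) (hδ : IsDualChamber Δ δ) {z : StrongDual ℝ V} (hz : z ≠ 0) :
    ∃ β ∈ Δ, (∀ y ∈ δ, 0 < y β) ∧ z β ≠ 0 := by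
  obtain ⟨α, hα, hzα⟩ : ∃ α ∈ Δ, z α ≠ 0 := by
    by_contra! h
    refine hz (ContinuousLinearMap.coe_injective (LinearMap.ext_on hspan fun α hα => ?_))
    exact h α hα
  obtain ⟨y₀, hy₀⟩ := hδ.nonempty
  rcases lt_or_gt_of_ne (hδ.subset hy₀ α hα) with h | h
  · exact ⟨-α, hneg α hα, hδ.pos_of_pos (hneg α hα) hy₀ (by simpa using h), by simpa using hzα⟩
  · exact ⟨α, hα, hδ.pos_of_pos hα hy₀ h, hzα⟩

lemma boundary_eq_zero_of_not_isWall [FiniteDimensional ℝ V] (ω : V [⋀^Fin r]→ₗ[ℝ] ℝ)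
    {z : StrongDual ℝ V} (hz : ¬ IsWall Δ (LinearMap.ker (z : V →ₗ[ℝ] ℝ))) (c : Comb Δ δ r)
    (y : StrongDual ℝ V) : boundary ω z c y = 0 := by
  induction c using Comb.induction with
  | zero => simp
  | add c d hc hd => simp [hc, hd]
  | smul a c hc => simp [hc]
  | single b m =>
    rw [boundary_single, one_smul]
    refine genBoundary_of_forall_not ω (fun i hi => absurd ?_ hz) y
    rw [hi.ker_eq]
    exact isWall_ker_coord b.basis b.mem i

lemma mem_reg_of_mem_regAlong {V₀ : Submodule ℝ V} {h : V} (hh : h ∈ regAlong Δ V₀)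
    (h0 : h ∉ V₀) : h ∈ reg Δ := fun W hW => by
  by_cases hWV : W = V₀
  · rwa [hWV]
  · exact hh W hW hWV

lemma eventually_add_smul_mem_dualReg {y : StrongDual ℝ V} (hy : y ∈ dualReg Δ)
    (z : StrongDual ℝ V) : ∀ᶠ t : ℝ in Bornology.cobounded ℝ, y + t • z ∈ dualReg Δ := by
  refine (Filter.eventually_all_finset Δ).2 fun α hα => ?_
  by_cases hzα : z α = 0
  · exact Eventually.of_forall fun t => by simpa [hzα] using hy α hα
  · filter_upwards [eventually_add_mul_ne_zero (y α) hzα] with t ht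
    simpa using ht

section

variable [FiniteDimensional ℝ V] {z : StrongDual ℝ V}

lemma nhdsWithin_le_nhdsWithin_reg {w : V} (hw : w ∈ regAlong Δ (LinearMap.ker (z : V →ₗ[ℝ] ℝ)))
    {S : Set V} (hS : ∀ h ∈ S, z h ≠ 0) : 𝓝[S] w ≤ 𝓝[reg Δ] w := by
  refine nhdsWithin_le_of_mem ?_
  filter_upwards [self_mem_nhdsWithin, nhdsWithin_le_nhds ((isOpen_regAlong Δ _).mem_nhds hw)]
    with h hh hh'
  exact mem_reg_of_mem_regAlong hh' (hS h hh)

lemma neBot_nhdsWithin_pos (hz : z ≠ 0) {w : V} (hw : z w = 0) :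
    (𝓝[{h | 0 < z h}] w).NeBot := by
  obtain ⟨v, hv⟩ : ∃ v, z v ≠ 0 := by
    by_contra! h
    exact hz (ContinuousLinearMap.ext h)
  have hc : Tendsto (fun t : ℝ => w + t • ((z v)⁻¹ • v)) (𝓝[>] 0) (𝓝 w) := by
    have : Continuous fun t : ℝ => w + t • ((z v)⁻¹ • v) := by fun_prop
    exact (this.tendsto' 0 w (by simp)).mono_left nhdsWithin_le_nhds
  refine (tendsto_nhdsWithin_iff.2 ⟨hc, ?_⟩).neBot
  filter_upwards [self_mem_nhdsWithin] with t ht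
  simpa [hw, hv] using ht

lemma neBot_nhdsWithin_neg (hz : z ≠ 0) {w : V} (hw : z w = 0) :
    (𝓝[{h | z h < 0}] w).NeBot := by
  have := neBot_nhdsWithin_pos (neg_ne_zero.2 hz) (w := w) (by simpa using hw)
  simpa using this

variable [MeasurableSpace V] [BorelSpace V] [Fact (finrank ℝ V = r)]

/-- One direction is injectivity of the Laplace transform on the open set `δ`; the other is
vanishing on `δ`, spread to all regular points by the identity theorem. -/
lemma lap_eq_zero_iff_ae (hδ : IsDualChamber Δ δ) (ω : V [⋀^Fin r]→ₗ[ℝ] ℝ) (d : Comb Δ δ r) :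
    (∀ y ∈ dualReg Δ, lap ω d y = 0) ↔ fn d =ᵐ[ω.measure] 0 := by
  constructor
  · intro h
    refine ae_eq_zero_of_laplace_eq_zero (measurable_fn d) hδ.isOpen hδ.nonempty
      (fun y hy => integrable_exp_mul_fn ω d hy) fun y hy => ?_
    rw [integral_exp_mul_fn ω d hy, h y (hδ.subset hy)]
  · intro h
    refine (isAnalyticUpToPoles_lap ω d).eqOn_zero hδ fun y hy => ?_
    rw [← integral_exp_mul_fn ω d hy]
    refine (integral_congr_ae ?_).trans (integral_zero V ℝ)
    filter_upwards [h] with x hx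
    rw [hx, Pi.zero_apply, mul_zero]

lemma dense_of_ae_measure {ω : V [⋀^Fin r]→ₗ[ℝ] ℝ} (hω : ω ≠ 0) {p : V → Prop}
    (hp : ∀ᵐ x ∂ω.measure, p x) : Dense {x | p x} := by
  let b := finBasisOfFinrankEq ℝ V (Fact.out : finrank ℝ V = r)
  rw [measure_eq_smul_addHaar ω b, Measure.ae_ennreal_smul_measure_iff (by
    simpa using (ω.map_basis_ne_zero_iff b).2 hω)] at hp
  exact Measure.dense_of_ae hp

/-- The map `p` fixes the hyperplane `z = 0` pointwise, so the preimage under `p` of a different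
wall is a proper subspace, hence null. -/
lemma ae_projection_mem_regAlong (ω : V [⋀^Fin r]→ₗ[ℝ] ℝ)
    (hW₀ : IsWall Δ (LinearMap.ker (z : V →ₗ[ℝ] ℝ))) (β : V) :
    ∀ᵐ h ∂ω.measure, h - (z h / z β) • β ∈ regAlong Δ (LinearMap.ker (z : V →ₗ[ℝ] ℝ)) := by
  let p : V →ₗ[ℝ] V := LinearMap.id - ((z β)⁻¹ • (z : V →ₗ[ℝ] ℝ)).smulRight β
  have hp : ∀ h, p h = h - (z h / z β) • β := fun h => by
    simp [p, div_eq_inv_mul]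
  have : ∀ᵐ h ∂ω.measure, ∀ W ∈ {W : Submodule ℝ V | IsWall Δ W},
      W ≠ LinearMap.ker (z : V →ₗ[ℝ] ℝ) → p h ∉ W := by
    refine (ae_ball_iff (finite_setOf_isWall Δ).countable).2 fun W hW => ?_
    by_cases hne : W = LinearMap.ker (z : V →ₗ[ℝ] ℝ)
    · exact ae_of_all _ fun _ h => absurd hne h
    · have htop : W.comap p ≠ ⊤ := by
        intro h
        have hle : LinearMap.ker (z : V →ₗ[ℝ] ℝ) ≤ W := by
          intro v hv
          have hvp : v ∈ W.comap p := by rw [h]; trivial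
          rw [Submodule.mem_comap, hp] at hvp
          have hv : z v = 0 := hv
          simpa [hv] using hvp
        have h1 := IsWall.finrank_add_one hW
        have h2 := hW₀.finrank_add_one
        exact hne (Submodule.eq_of_le_of_finrank_eq hle (by omega)).symm
      filter_upwards [ae_notMem_submodule ω htop] with h hh _ using hh
  filter_upwards [this] with h hh W hW hne
  rw [← hp]
  exact hh W hW hne

/-- A combination which extends continuously along a wall has vanishing leading coefficient at
infinity in the direction of an equation of the wall. -/
lemma boundary_eq_zero_of_extOn (hspan : Submodule.span ℝ (Δ : Set V) = ⊤)
    (hneg : ∀ α ∈ Δ, -α ∈ Δ) (hδ : IsDualChamber Δ δ) (ω : V [⋀^Fin r]→ₗ[ℝ] ℝ)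
    (hW₀ : IsWall Δ (LinearMap.ker (z : V →ₗ[ℝ] ℝ))) {c : Comb Δ δ r}
    (hc : ExtOn Δ (fn c) 0 (regAlong Δ (LinearMap.ker (z : V →ₗ[ℝ] ℝ)))) :
    ∀ y ∈ dualReg Δ, boundary ω z c y = 0 := by
  have hz := ne_zero_of_isWall_ker hW₀
  obtain ⟨β, hβ, hpos, hzβ⟩ := exists_pos_of_ne_zero hspan hneg hδ hz
  obtain ⟨d, hlap, hnonpos, hjump⟩ := exists_jump ω hβ hpos hzβ c
  obtain ⟨g, hg, hgc⟩ := hc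
  rw [Nat.cast_zero, contDiffOn_zero] at hgc
  have hd0 : ∀ w ∈ regAlong Δ (LinearMap.ker (z : V →ₗ[ℝ] ℝ)), z w = 0 → ∀ s : ℝ, 0 < s →
      fn d (w + s • β) = 0 := by
    intro w hw hzw s hs
    obtain ⟨-, a, ha, hb⟩ := hjump w hw hzw s hs
    have hgw : Tendsto (fn c) (𝓝[reg Δ] w) (𝓝 (g w)) := by
      refine ((hgc.continuousAt ((isOpen_regAlong Δ _).mem_nhds hw)).tendsto.mono_left
        nhdsWithin_le_nhds).congr' ?_
      filter_upwards [self_mem_nhdsWithin] with h hh using hg h hh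
    have := neBot_nhdsWithin_pos hz hzw
    have := neBot_nhdsWithin_neg hz hzw
    have e1 := tendsto_nhds_unique ha
      (hgw.mono_left (nhdsWithin_le_nhdsWithin_reg hw fun h (hh : z h < 0) => hh.ne))
    have e2 := tendsto_nhds_unique hb
      (hgw.mono_left (nhdsWithin_le_nhdsWithin_reg hw fun h (hh : 0 < z h) => hh.ne'))
    linarith
  have hae : fn d =ᵐ[ω.measure] 0 := by
    filter_upwards [ae_projection_mem_regAlong ω hW₀ β] with h hh
    -- On one side `fn d` vanishes by construction; a point of the other side is its projection to
    -- the wall plus a positive multiple of `β`, where `fn d` is the jump, now zero.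
    rcases le_or_gt (z h / z β) 0 with hle | hgt
    · exact hnonpos h hle
    · have := hd0 _ hh (by simp [hzβ]) _ hgt
      rwa [sub_add_cancel] at this
  intro y hy
  have h0 := (lap_eq_zero_iff_ae hδ ω d).2 hae y hy
  rw [hlap y hy] at h0
  have hyβ := hy β hβ
  simpa [hzβ, hyβ] using h0

/-- The jump function `fn d` has zero Laplace transform, so it vanishes almost everywhere. Being
continuous at `w + β`, it vanishes there, and the two one-sided limits of `fn c` at `w` coincide. -/
lemma exists_tendsto_of_boundary_eq_zero (hspan : Submodule.span ℝ (Δ : Set V) = ⊤)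
    (hneg : ∀ α ∈ Δ, -α ∈ Δ) (hδ : IsDualChamber Δ δ) {ω : V [⋀^Fin r]→ₗ[ℝ] ℝ} (hω : ω ≠ 0)
    (hW₀ : IsWall Δ (LinearMap.ker (z : V →ₗ[ℝ] ℝ))) {c : Comb Δ δ r}
    (hc : ∀ y ∈ dualReg Δ, boundary ω z c y = 0) :
    ∀ w ∈ regAlong Δ (LinearMap.ker (z : V →ₗ[ℝ] ℝ)),
      ∃ a, Tendsto (fn c) (𝓝[reg Δ] w) (𝓝 a) := by
  intro w hw
  have hz := ne_zero_of_isWall_ker hW₀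
  by_cases hzw : z w = 0
  · obtain ⟨β, hβ, hpos, hzβ⟩ := exists_pos_of_ne_zero hspan hneg hδ hz
    obtain ⟨d, hlap, -, hjump⟩ := exists_jump ω hβ hpos hzβ c
    obtain ⟨hcont, a, ha, hb⟩ := hjump w hw hzw 1 one_pos
    have hae : fn d =ᵐ[ω.measure] 0 := (lap_eq_zero_iff_ae hδ ω d).1 fun y hy => by
      rw [hlap y hy, hc y hy, mul_zero, zero_div]
    have hdense := dense_of_ae_measure hω hae
    have hNB : (𝓝[{x | fn d x = (0 : V → ℝ) x}] (w + (1 : ℝ) • β)).NeBot :=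
      mem_closure_iff_nhdsWithin_neBot.1 (hdense _)
    have h0 : fn d (w + (1 : ℝ) • β) = 0 := by
      refine tendsto_nhds_unique (hcont.tendsto.mono_left
        (nhdsWithin_le_nhds (s := {x | fn d x = (0 : V → ℝ) x}))) ?_
      refine tendsto_const_nhds.congr' ?_
      filter_upwards [self_mem_nhdsWithin] with x hx using hx.symm
    rw [h0, add_zero] at hb
    refine ⟨a, ?_⟩
    have hsub : reg Δ ⊆ {h | z h < 0} ∪ {h | 0 < z h} := fun h hh =>
      lt_or_gt_of_ne fun h0 : z h = 0 => hh _ hW₀ h0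
    refine Tendsto.mono_left ?_ (nhdsWithin_mono w hsub)
    rw [nhdsWithin_union]
    exact ha.sup hb
  · have hwr : w ∈ reg Δ := mem_reg_of_mem_regAlong hw hzw
    exact ⟨_, (continuousAt_fn c hwr).tendsto.mono_left nhdsWithin_le_nhds⟩

lemma extOn_regAlong_zero_iff (hspan : Submodule.span ℝ (Δ : Set V) = ⊤)
    (hneg : ∀ α ∈ Δ, -α ∈ Δ) (hδ : IsDualChamber Δ δ) {ω : V [⋀^Fin r]→ₗ[ℝ] ℝ} (hω : ω ≠ 0)
    (hW₀ : IsWall Δ (LinearMap.ker (z : V →ₗ[ℝ] ℝ))) (c : Comb Δ δ r) :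
    ExtOn Δ (fn c) 0 (regAlong Δ (LinearMap.ker (z : V →ₗ[ℝ] ℝ))) ↔
      ∀ y ∈ dualReg Δ, boundary ω z c y = 0 := by
  refine ⟨boundary_eq_zero_of_extOn hspan hneg hδ ω hW₀, fun h => ?_⟩
  obtain ⟨hg, hgc⟩ := extOn_zero_of_forall_tendsto c
    (exists_tendsto_of_boundary_eq_zero hspan hneg hδ hω hW₀ h)
  exact ⟨_, hg, by rw [Nat.cast_zero, contDiffOn_zero]; exact hgc⟩

lemma extOn_univ_zero_iff (hspan : Submodule.span ℝ (Δ : Set V) = ⊤)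
    (hneg : ∀ α ∈ Δ, -α ∈ Δ) (hδ : IsDualChamber Δ δ) {ω : V [⋀^Fin r]→ₗ[ℝ] ℝ} (hω : ω ≠ 0)
    (c : Comb Δ δ r) :
    ExtOn Δ (fn c) 0 univ ↔
      ∀ z : StrongDual ℝ V, z ≠ 0 → ∀ y ∈ dualReg Δ, boundary ω z c y = 0 := by
  constructor
  · intro h z _ y hy
    by_cases hW : IsWall Δ (LinearMap.ker (z : V →ₗ[ℝ] ℝ))
    · exact boundary_eq_zero_of_extOn hspan hneg hδ ω hW (h.mono le_rfl (subset_univ _)) y hy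
    · exact boundary_eq_zero_of_not_isWall ω hW c y
  · intro h
    refine extOn_univ_of_atMostOneWall Fact.out c fun x hx => ?_
    by_cases hxr : x ∈ reg Δ
    · exact ⟨_, (continuousAt_fn c hxr).tendsto.mono_left nhdsWithin_le_nhds⟩
    · simp only [reg, mem_ofPred_eq, not_forall, not_not] at hxr
      obtain ⟨W, hW, hxW⟩ := hxr
      obtain ⟨z, hz, rfl⟩ := hW.exists_eq_ker
      exact exists_tendsto_of_boundary_eq_zero hspan hneg hδ hω hW (h z hz) x
        fun W' hW' hne hxW' => hne (hx W' _ hW' hW hxW' hxW)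

/-! ### Order of vanishing at infinity -/

/-- The Laplace transform of `c` vanishes at order `k + 2` at infinity in the direction `z`. -/
def Decays (ω : V [⋀^Fin r]→ₗ[ℝ] ℝ) (c : Comb Δ δ r) (k : ℕ) (z : StrongDual ℝ V) : Prop :=
  ∀ y ∈ dualReg Δ, Tendsto (fun t : ℝ => t ^ (k + 1) * lap ω c (y + t • z))
    (Bornology.cobounded ℝ) (𝓝 0)

lemma decays_zero_iff (ω : V [⋀^Fin r]→ₗ[ℝ] ℝ) (hz : z ≠ 0) (c : Comb Δ δ r) :
    Decays ω c 0 z ↔ ∀ y ∈ dualReg Δ, boundary ω z c y = 0 := by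
  refine forall₂_congr fun y _ => ?_
  have hNB : (Bornology.cobounded ℝ).NeBot := inferInstance
  have h := tendsto_mul_lap ω hz c y
  simp only [zero_add, pow_one]
  exact ⟨fun h' => tendsto_nhds_unique h h', fun h' => h' ▸ h⟩

lemma tendsto_inv_mul_pow_mul {F : ℝ → ℝ} {k : ℕ}
    (h : Tendsto (fun t : ℝ => t ^ (k + 1) * F t) (Bornology.cobounded ℝ) (𝓝 0)) :
    Tendsto (fun t : ℝ => t ^ k * F t) (Bornology.cobounded ℝ) (𝓝 0) := by
  have h1 := tendsto_inv₀_cobounded (α := ℝ).mul h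
  rw [mul_zero] at h1
  refine h1.congr' ?_
  filter_upwards [eventually_cobounded_ne 0] with t ht
  rw [pow_succ]
  field_simp

lemma Decays.of_succ {ω : V [⋀^Fin r]→ₗ[ℝ] ℝ} {c : Comb Δ δ r} {k : ℕ}
    (h : Decays ω c (k + 1) z) : Decays ω c k z :=
  fun y hy => tendsto_inv_mul_pow_mul (h y hy)

/-- The transform gets multiplied by `y v + t * z v`, which costs at most one order. -/
lemma Decays.dirDeriv {ω : V [⋀^Fin r]→ₗ[ℝ] ℝ} {c : Comb Δ δ r} {v : V}
    (hv : ∀ y ∈ dualReg Δ, lap ω (dirDeriv v c) y = y v * lap ω c y) {k : ℕ}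
    (h : Decays ω c (k + 1) z) : Decays ω (HyperplaneLaplace.dirDeriv v c) k z := by
  intro y hy
  have h1 := (h.of_succ y hy).const_mul (y v)
  have h2 := (h y hy).const_mul (z v)
  have h3 := h1.add h2
  rw [mul_zero, mul_zero, add_zero] at h3
  refine h3.congr' ?_
  filter_upwards [eventually_add_smul_mem_dualReg hy z] with t ht
  rw [hv _ ht, add_apply, smul_apply, smul_eq_mul]
  ring

/-- If `z v ≠ 0`, dividing by `y v + t * z v` gains the order back. -/
lemma Decays.of_dirDeriv {ω : V [⋀^Fin r]→ₗ[ℝ] ℝ} {c : Comb Δ δ r} {v : V}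
    (hv : ∀ y ∈ dualReg Δ, lap ω (HyperplaneLaplace.dirDeriv v c) y = y v * lap ω c y)
    (hzv : z v ≠ 0) {k : ℕ} (h : Decays ω (HyperplaneLaplace.dirDeriv v c) k z) :
    Decays ω c (k + 1) z := by
  intro y hy
  have h1 := (tendsto_mul_inv_add_mul (y v) hzv).mul (h y hy)
  rw [mul_zero] at h1
  refine h1.congr' ?_
  filter_upwards [eventually_add_smul_mem_dualReg hy z, eventually_add_mul_ne_zero (y v) hzv]
    with t ht ht'
  rw [hv _ ht, add_apply, smul_apply, smul_eq_mul]
  field_simp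
  ring

lemma lap_dirDeriv_of_extOn (hspan : Submodule.span ℝ (Δ : Set V) = ⊤)
    (hneg : ∀ α ∈ Δ, -α ∈ Δ) (hδ : IsDualChamber Δ δ) {ω : V [⋀^Fin r]→ₗ[ℝ] ℝ} (hω : ω ≠ 0)
    {c : Comb Δ δ r} (hc : ExtOn Δ (fn c) 0 univ) (v : V) :
    ∀ y ∈ dualReg Δ, lap ω (dirDeriv v c) y = y v * lap ω c y :=
  fun _ hy => lap_dirDeriv ω c ((extOn_univ_zero_iff hspan hneg hδ hω c).1 hc) v hy

/-- A combination extends to a function of class `C^k` on `V` if and only if its Laplace transform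
vanishes at order `k + 2` at infinity. -/
theorem extOn_univ_iff_decays (hspan : Submodule.span ℝ (Δ : Set V) = ⊤)
    (hneg : ∀ α ∈ Δ, -α ∈ Δ) (hδ : IsDualChamber Δ δ) {ω : V [⋀^Fin r]→ₗ[ℝ] ℝ} (hω : ω ≠ 0)
    (k : ℕ) (c : Comb Δ δ r) :
    ExtOn Δ (fn c) k univ ↔ ∀ z : StrongDual ℝ V, z ≠ 0 → Decays ω c k z := by
  have hzero : ∀ c : Comb Δ δ r,
      ExtOn Δ (fn c) 0 univ ↔ ∀ z : StrongDual ℝ V, z ≠ 0 → Decays ω c 0 z := fun c =>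
    (extOn_univ_zero_iff hspan hneg hδ hω c).trans
      (forall₂_congr fun z hz => (decays_zero_iff ω hz c).symm)
  induction k generalizing c with
  | zero => exact hzero c
  | succ k ih =>
    rw [extOn_succ_iff Fact.out c k isOpen_univ]
    constructor
    · rintro ⟨h0, hd⟩ z hz
      obtain ⟨v, hv⟩ : ∃ v, z v ≠ 0 := by
        by_contra! h
        exact hz (ContinuousLinearMap.ext h)
      exact Decays.of_dirDeriv (lap_dirDeriv_of_extOn hspan hneg hδ hω h0 v) hv
        ((ih _).1 (hd v) z hz)
    · intro h
      have h0 : ExtOn Δ (fn c) 0 univ := by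
        refine (hzero c).2 fun z hz => ?_
        have : ∀ j, Decays ω c j z → Decays ω c 0 z := by
          intro j
          induction j with
          | zero => exact id
          | succ j ihj => exact fun hj => ihj hj.of_succ
        exact this _ (h z hz)
      exact ⟨h0, fun v => (ih _).2 fun z hz =>
        (h z hz).dirDeriv (lap_dirDeriv_of_extOn hspan hneg hδ hω h0 v)⟩

/-- A combination which extends to a function of class `C^k` on `V` extends to a function of class
`C^(k+1)` along a wall if and only if its Laplace transform vanishes at order `k + 3` at infinity
in the direction of an equation of the wall. -/
theorem extOn_regAlong_iff_decays (hspan : Submodule.span ℝ (Δ : Set V) = ⊤)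
    (hneg : ∀ α ∈ Δ, -α ∈ Δ) (hδ : IsDualChamber Δ δ) {ω : V [⋀^Fin r]→ₗ[ℝ] ℝ} (hω : ω ≠ 0)
    (hW₀ : IsWall Δ (LinearMap.ker (z : V →ₗ[ℝ] ℝ))) (k : ℕ) (c : Comb Δ δ r)
    (hc : ExtOn Δ (fn c) k univ) :
    ExtOn Δ (fn c) (k + 1) (regAlong Δ (LinearMap.ker (z : V →ₗ[ℝ] ℝ))) ↔
      Decays ω c (k + 1) z := by
  have hz := ne_zero_of_isWall_ker hW₀
  -- Passing to derivatives needs continuity on all of `V`, not just along the wall, because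
  -- boundary terms of every wall enter the derivative rule.
  have hstep : ∀ (k : ℕ) (c : Comb Δ δ r), ExtOn Δ (fn c) 0 univ →
      (∀ v, ExtOn Δ (fn (dirDeriv v c)) k (regAlong Δ (LinearMap.ker (z : V →ₗ[ℝ] ℝ))) ↔
        Decays ω (dirDeriv v c) k z) →
      (ExtOn Δ (fn c) (k + 1) (regAlong Δ (LinearMap.ker (z : V →ₗ[ℝ] ℝ))) ↔
        Decays ω c (k + 1) z) := by
    intro k c h0 h
    have hlap := lap_dirDeriv_of_extOn hspan hneg hδ hω h0
    rw [extOn_succ_iff Fact.out c k (isOpen_regAlong Δ _)]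
    constructor
    · rintro ⟨-, hd⟩
      obtain ⟨v, hv⟩ : ∃ v, z v ≠ 0 := by
        by_contra! h
        exact hz (ContinuousLinearMap.ext h)
      exact Decays.of_dirDeriv (hlap v) hv ((h v).1 (hd v))
    · intro hd
      exact ⟨h0.mono le_rfl (subset_univ _), fun v => (h v).2 (hd.dirDeriv (hlap v))⟩
  induction k generalizing c with
  | zero =>
    exact hstep 0 c hc fun v => (extOn_regAlong_zero_iff hspan hneg hδ hω hW₀ _).trans
      (decays_zero_iff ω hz _).symm
  | succ k ih =>
    exact hstep (k + 1) c (hc.mono (Nat.zero_le _) subset_rfl) fun v => ih _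
      (((extOn_succ_iff Fact.out c k isOpen_univ).1 hc).2 v)

end

end

section

variable {V : Type*} [NormedAddCommGroup V] [NormedSpace ℝ V]
  {Δ : Finset V} {δ : Set (StrongDual ℝ V)} {r : ℕ}

/-! ### Orientations and the inverse Laplace transform -/

lemma extendByZero_of_mem {X : Type*} {S : Set X} (f : S → ℝ) {x : X} (hx : x ∈ S) :
    extendByZero S f x = f ⟨x, hx⟩ :=
  Subtype.val_injective.extend_apply f 0 ⟨x, hx⟩

section

variable [FiniteDimensional ℝ V] [Fact (finrank ℝ V = r)]

lemma exists_eq_smul_of_ne_zero {ω₀ : V [⋀^Fin r]→ₗ[ℝ] ℝ} (hω₀ : ω₀ ≠ 0)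
    (ω : V [⋀^Fin r]→ₗ[ℝ] ℝ) : ∃ a : ℝ, ω = a • ω₀ := by
  let b := finBasisOfFinrankEq ℝ V (Fact.out : finrank ℝ V = r)
  have hb : ω₀ b ≠ 0 := (ω₀.map_basis_ne_zero_iff b).2 hω₀
  have h := congrArg (fun η => (ω b / ω₀ b) • η) (ω₀.eq_smul_basis_det b)
  simp only [smul_smul, div_mul_cancel₀ _ hb] at h
  exact ⟨ω b / ω₀ b, (ω.eq_smul_basis_det b).trans h.symm⟩

/-- Top-degree forms are all multiples of `ω₀`, so a vector killed by `ω₀` is killed by every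
functional on `⋀^r V`. -/
lemma alternatingMapLinearEquiv_apply_ne_zero {ω₀ : V [⋀^Fin r]→ₗ[ℝ] ℝ} (hω₀ : ω₀ ≠ 0)
    {dy : ⋀[ℝ]^r V} (hdy : dy ≠ 0) : exteriorPower.alternatingMapLinearEquiv ω₀ dy ≠ 0 := by
  intro h
  refine hdy ((Module.forall_dual_apply_eq_zero_iff ℝ dy).1 fun L => ?_)
  obtain ⟨a, ha⟩ := exists_eq_smul_of_ne_zero hω₀ (exteriorPower.alternatingMapLinearEquiv.symm L)
  rw [LinearEquiv.symm_apply_eq] at ha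
  rw [ha, map_smul, LinearMap.smul_apply, h, smul_zero]

variable [MeasurableSpace V] [BorelSpace V]

lemma measure_smul (a : ℝ) (ω : V [⋀^Fin r]→ₗ[ℝ] ℝ) :
    (a • ω).measure = ENNReal.ofReal |a| • ω.measure := by
  let b := finBasisOfFinrankEq ℝ V (Fact.out : finrank ℝ V = r)
  rw [measure_eq_smul_addHaar _ b, measure_eq_smul_addHaar ω b, smul_smul,
    ← ENNReal.ofReal_mul (abs_nonneg a), ← abs_mul]
  rfl

/-- The density contributes `|a|` and the orientation the sign of `a`; for `a = 0` both sides
vanish. -/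
lemma orientedIntegral_smul {ω₀ : V [⋀^Fin r]→ₗ[ℝ] ℝ} (hω₀ : ω₀ ≠ 0) (g : V → ℝ) (a : ℝ) :
    orientedIntegral (rayOfNeZero ℝ ω₀ hω₀) g (a • ω₀) = a * ∫ h, g h ∂ω₀.measure := by
  have hiff : (∃ hω : a • ω₀ ≠ 0, rayOfNeZero ℝ (a • ω₀) hω = rayOfNeZero ℝ ω₀ hω₀) ↔ 0 < a := by
    constructor
    · rintro ⟨hω, h⟩
      have ha : a ≠ 0 := fun h0 => hω (by rw [h0, zero_smul])
      exact (sameRay_smul_left_iff_of_ne hω₀ ha).1 ((ray_eq_iff hω hω₀).1 h)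
    · intro ha
      refine ⟨smul_ne_zero ha.ne' hω₀, (ray_eq_iff _ _).2 ?_⟩
      exact (sameRay_smul_left_iff_of_ne hω₀ ha.ne').2 ha
  rw [orientedIntegral, measure_smul, integral_smul_measure,
    ENNReal.toReal_ofReal (abs_nonneg a), smul_eq_mul]
  by_cases ha : 0 < a
  · rw [if_pos (hiff.2 ha), abs_of_pos ha]
  · rw [if_neg fun h => ha (hiff.1 h), abs_of_nonpos (not_lt.1 ha), neg_mul, neg_neg]

/-- The Laplace transform of a locally polynomial function given by a combination. -/
lemma laplace_smul_eq {ω₀ : V [⋀^Fin r]→ₗ[ℝ] ℝ} (hω₀ : ω₀ ≠ 0) {f : reg Δ → ℝ}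
    {c : Comb Δ δ r} (hf : ∀ h : reg Δ, f h = fn c (h : V)) {y : StrongDual ℝ V} (hy : y ∈ δ)
    (a : ℝ) : laplace (rayOfNeZero ℝ ω₀ hω₀) f y (a • ω₀) = a * lap ω₀ c y := by
  rw [laplace, orientedIntegral_smul, ← integral_exp_mul_fn ω₀ c hy]
  congr 1
  refine integral_congr_ae ?_
  filter_upwards [ae_mem_reg ω₀ Δ] with h hh
  rw [extendByZero_of_mem f hh, hf]

/-- The inverse Laplace transform is given by a combination, whose Laplace transform is a nonzero
multiple of the given rational function. -/
lemma exists_fn_eq_invLaplace (o : Orientation ℝ V (Fin r)) (hneg : ∀ α ∈ Δ, -α ∈ Δ)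
    (hδ : IsDualChamber Δ δ) {dy : ⋀[ℝ]^r V} (hdy : dy ≠ 0) {φ : dualReg Δ → ℝ} (hφ : φ ∈ G Δ) :
    ∃ (ω : V [⋀^Fin r]→ₗ[ℝ] ℝ) (a : ℝ) (c : Comb Δ δ r), ω ≠ 0 ∧ a ≠ 0 ∧
      (∀ h : reg Δ, invLaplace o δ φ dy h = fn c (h : V)) ∧
      ∀ y : dualReg Δ, lap ω c (y : StrongDual ℝ V) = a * φ y := by
  obtain ⟨ω, hω, rfl⟩ : ∃ (ω : V [⋀^Fin r]→ₗ[ℝ] ℝ) (hω : ω ≠ 0), rayOfNeZero ℝ ω hω = o :=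
    ⟨o.someVector, o.someVector_ne_zero, o.someVector_ray⟩
  set a := exteriorPower.alternatingMapLinearEquiv ω dy with ha
  have ha0 : a ≠ 0 := alternatingMapLinearEquiv_apply_ne_zero hω hdy
  obtain ⟨c₀, hc₀⟩ := exists_lap_eq_of_mem_G Fact.out hδ hneg hω hφ
  have H : ∃ f ∈ locPoly Δ δ, IsLaplaceTransform (rayOfNeZero ℝ ω hω) δ f φ dy := by
    refine ⟨_, fn_mem_locPoly (a • c₀), fun y hy ω' => ?_⟩
    obtain ⟨x, rfl⟩ := exists_eq_smul_of_ne_zero hω ω'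
    rw [laplace_smul_eq hω (fun _ => rfl) hy, map_smul, Pi.smul_apply, hc₀, map_smul,
      LinearMap.smul_apply, ← ha, smul_eq_mul, smul_eq_mul]
    ring
  obtain ⟨hmem, hlap⟩ := H.choose_spec
  have hinv : invLaplace (rayOfNeZero ℝ ω hω) δ φ dy = H.choose := dif_pos H
  obtain ⟨c, hc⟩ := exists_fn_of_mem_locPoly (r := r) Fact.out hδ hmem
  refine ⟨ω, a, c, hω, ha0, fun h => by rw [hinv, hc], fun y => ?_⟩
  -- The chosen `f` and the one built from partial fractions need not be compared as functions:
  -- equality of their transforms on `δ`, hence at all regular points, is enough.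
  have hzero : ∀ y ∈ δ, lap ω (c - a • c₀) y = 0 := by
    intro y hy
    have h1 := laplace_smul_eq hω hc hy 1
    rw [one_smul, one_mul] at h1
    have h2 := hlap ⟨y, hδ.subset hy⟩ hy ω
    rw [h1, ← ha] at h2
    have h3 := hc₀ ⟨y, hδ.subset hy⟩
    simp only [map_sub, map_smul, Pi.sub_apply, Pi.smul_apply, smul_eq_mul, h2, h3]
    ring
  have := (isAnalyticUpToPoles_lap ω (c - a • c₀)).eqOn_zero hδ hzero y y.2
  rw [map_sub, map_smul, Pi.sub_apply, Pi.smul_apply, hc₀, sub_eq_zero] at this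
  exact this

end

/-! ### The conditions of the theorem in terms of combinations. -/

lemma extendsOfClass_iff {f : reg Δ → ℝ} {F : V → ℝ} (hf : ∀ h : reg Δ, f h = F h) (k : ℕ) :
    ExtendsOfClass f k ↔ ExtOn Δ F k univ := by
  refine exists_congr fun g => ?_
  rw [contDiffOn_univ, Subtype.forall]
  simp only [hf]

lemma extendsOfClassAlong_iff {f : reg Δ → ℝ} {F : V → ℝ} (hf : ∀ h : reg Δ, f h = F h) (k : ℕ)
    (V₀ : Submodule ℝ V) : ExtendsOfClassAlong f k V₀ ↔ ExtOn Δ F k (regAlong Δ V₀) := by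
  refine exists_congr fun g => ?_
  rw [Subtype.forall]
  simp only [hf]

/-- For large `|t|` the point `y + t • z` is regular, so the extension by zero plays no role. Order
`k + 2` corresponds to the factor `t ^ (k + 1)`. -/
lemma vanishesAtOrderAlong_iff {ω : V [⋀^Fin r]→ₗ[ℝ] ℝ} {a : ℝ} (ha : a ≠ 0) {c : Comb Δ δ r}
    {φ : dualReg Δ → ℝ} (h : ∀ y : dualReg Δ, lap ω c (y : StrongDual ℝ V) = a * φ y) (k : ℕ)
    (z : StrongDual ℝ V) :
    (∀ y ∈ dualReg Δ, VanishesAtOrderAlong φ (k + 2) y z) ↔ Decays ω c k z := by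
  refine forall₂_congr fun y hy => ?_
  have heq : (fun t : ℝ => t ^ (k + 1) * lap ω c (y + t • z)) =ᶠ[Bornology.cobounded ℝ]
      fun t => a * (t ^ (k + 2 - 1) * extendByZero (dualReg Δ) φ (y + t • z)) := by
    filter_upwards [eventually_add_smul_mem_dualReg hy z] with t ht
    rw [extendByZero_of_mem φ ht, h ⟨_, ht⟩, mul_left_comm]
    rfl
  rw [VanishesAtOrderAlong, tendsto_congr' heq]
  refine ⟨fun h => by simpa using h.const_mul a, fun h => ?_⟩
  have := h.const_mul a⁻¹
  simpa only [inv_mul_cancel_left₀ ha, mul_zero] using this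

end

end HyperplaneLaplace

end

/-! ### The main theorem. -/

theorem mainTheorem10 {V : Type*} [NormedAddCommGroup V] [NormedSpace ℝ V]
    [FiniteDimensional ℝ V] [MeasurableSpace V] [BorelSpace V]
    {r : ℕ} [Fact (Module.finrank ℝ V = r)] (o : Orientation ℝ V (Fin r))
    (Δ : Finset V) (hzero : (0 : V) ∉ Δ) (hspan : Submodule.span ℝ (Δ : Set V) = ⊤)
    (hneg : ∀ α ∈ Δ, -α ∈ Δ)
    (δ : Set (StrongDual ℝ V)) (hδ : HyperplaneLaplace.IsDualChamber Δ δ)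
    (dy : ⋀[ℝ]^r V) (hdy : dy ≠ 0)
    (φ : HyperplaneLaplace.dualReg Δ → ℝ) (hφ : φ ∈ HyperplaneLaplace.G Δ) (k : ℕ) :
    (HyperplaneLaplace.ExtendsOfClass (HyperplaneLaplace.invLaplace o δ φ dy) k ↔
      HyperplaneLaplace.VanishesAtOrder φ (k + 2)) ∧
    (HyperplaneLaplace.ExtendsOfClass (HyperplaneLaplace.invLaplace o δ φ dy) k ∨
        HyperplaneLaplace.VanishesAtOrder φ (k + 2) →
      ∀ (V₀ : Submodule ℝ V) (z₀ : StrongDual ℝ V), HyperplaneLaplace.IsWall Δ V₀ →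
        V₀ = LinearMap.ker (z₀ : V →ₗ[ℝ] ℝ) →
        (HyperplaneLaplace.ExtendsOfClassAlong
            (HyperplaneLaplace.invLaplace o δ φ dy) (k + 1) V₀ ↔
          ∀ z ∈ HyperplaneLaplace.dualReg Δ,
            HyperplaneLaplace.VanishesAtOrderAlong φ (k + 3) z z₀)) := by
  obtain ⟨ω, a, c, hω, ha, hf, hlap⟩ :=
    HyperplaneLaplace.exists_fn_eq_invLaplace o hneg hδ hdy hφ
  have hvan : HyperplaneLaplace.VanishesAtOrder φ (k + 2) ↔
      ∀ z : StrongDual ℝ V, z ≠ 0 → HyperplaneLaplace.Decays ω c k z := by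
    refine ⟨fun h z hz =>
      (HyperplaneLaplace.vanishesAtOrderAlong_iff ha hlap k z).1 fun y hy => h y hy z hz,
      fun h y hy z hz => (HyperplaneLaplace.vanishesAtOrderAlong_iff ha hlap k z).2 (h z hz) y hy⟩
  have hmain := HyperplaneLaplace.extOn_univ_iff_decays hspan hneg hδ hω k c
  have hext := HyperplaneLaplace.extendsOfClass_iff hf k
  refine ⟨hext.trans (hmain.trans hvan.symm), ?_⟩
  rintro hor V₀ z₀ hV₀ rfl
  have hk : HyperplaneLaplace.ExtOn Δ (HyperplaneLaplace.fn c) k univ :=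
    hor.elim hext.1 fun h => hmain.2 (hvan.1 h)
  rw [HyperplaneLaplace.extendsOfClassAlong_iff hf,
    HyperplaneLaplace.extOn_regAlong_iff_decays hspan hneg hδ hω hV₀ k c hk]
  exact (HyperplaneLaplace.vanishesAtOrderAlong_iff ha hlap (k + 1) z₀).symm
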